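/- **Conventions.** A *directed graph* $G$ has sets $V,E$ and maps $\mathfrak s,\mathfrak t\colon V\sqcup E\to V$ that are the identity on $V$; a *graph morphism* sends vertices to vertices and edges to edges or vertices, compatibly with $\mathfrak s,\mathfrak t$. A *smooth set* is a subset $A$ of a (nonempty, finite-dimensional, Hausdorff, second countable, boundaryless) smooth manifold $M_A$; a *smooth map* $A\to B$ is a germ along $A$ of smooth maps from neighbourhoods of $A$ to $M_B$ carrying $A$ into $B$. It is an *embedding* if some representative is a smooth embedding of a neighbourhood of $A$, and a *diffeomorphism* if it is an isomorphism of smooth sets. A *hybrid system* $H$ consists of a directed graph $G(H)$; for each vertex $v$ a manifold $M_v$, a smooth vector field $X_v$ on $M_v$, an active set $I_v\subset M_v$ and a flow set $F_v\subset I_v$ (possibly empty); and for each edge $e$ a (possibly empty) guard $Z_e\subset I_{\mathfrak s(e)}$ and a map $r_e\colon Z_e\to I_{\mathfrak t(e)}$. For a vertex $v$ put $Z_v:=F_v$ and let $r_v\colon F_v\to I_v$ be the inclusion. A *metric hybrid system* is a hybrid system with an extended metric on $I(H)=\bigsqcup_v I_v$ inducing its topology. A *hybrid semiconjugacy* $\alpha\colon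 H\to K$ is a graph morphism $\alpha$ with smooth maps $\alpha_v\colon I^H_v\to I^K_{\alpha(v)}$ such that $\alpha_v(F_v^H)\subset F^K_{\alpha(v)}$, $X^K_{\alpha(v)}\circ\alpha_v=T\alpha_v\circ X^H_v$ on $F^H_v$, and for each edge $e$, $\alpha_{\mathfrak s(e)}(Z_e^H)\subset Z^K_{\alpha(e)}$ and $\alpha_{\mathfrak t(e)}\circ r^H_e=r^K_{\alpha(e)}\circ\alpha_{\mathfrak s(e)}$ on $Z_e^H$. It is a *hybrid embedding* if its graph morphism is monic and every $\alpha_v$ is an embedding. For real $\varepsilon,T>0$ and $x,y\in I(H)$, an *$(\varepsilon,T)$-chain from $x$ to $y$* consists of times $0=\tau_0\le\dots\le\tau_N<\infty$ ($N\ge1$), vertices $\nu_0,\dots,\nu_{N-1}$, smooth maps $\varphi_j\colon[\tau_j,\tau_{j+1}]\to I_{\nu_j}$ which on $[\tau_j,\tau_{j+1})$ are integral curves of $X_{\nu_j}$ with values in $F_{\nu_j}$, and, for $0\le j<N-1$, elements $u_j\in V\sqcup E$ with $\mathfrak s(u_j)=\nu_j$, $\mathfrak t(u_j)=\nu_{j+1}$,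 $\varphi_j(\tau_{j+1})\in Z_{u_j}$ and $d(\varphi_{j+1}(\tau_{j+1}),r_{u_j}(\varphi_j(\tau_{j+1})))\le\varepsilon$, such that the jump times $\tau_{j+1}$ with $u_j\in V$ are at least $T$ apart from each other and from $\tau_0$, and $\varphi_0(0)=x$, $\varphi_{N-1}(\tau_N)=y$. A *directed hybrid system* $H\colon \overline H\leadsto\underline H$ is a metric hybrid system $H$ with a hybrid embedding $\overline\eta\colon\overline H\to H$ (initial) and a hybrid embedding $\underline\eta\colon\underline H\to H$ (final) identifying $\underline H$ with the restriction of $H$ to a sink, i.e. each $\underline\eta_v$ is a diffeomorphism with $\underline\eta_v(F_v^{\underline H})=F^H_{\underline\eta(v)}$, $\underline\eta_{\mathfrak s(e)}(Z_e^{\underline H})=Z^H_{\underline\eta(e)}$ for each edge $e$, and every edge of $G(H)$ starting at a vertex of $\underline\eta(G(\underline H))$ lies in $\underline\eta(G(\underline H))$; and such that for all real $\varepsilon,T>0$ and $x\in I(H)$ there is an $(\varepsilon,T)$-chain from $x$ to some point of $\underline\eta(I(\underline H))$. **Theorem.** There is a (pseudo) double category $\mathbf{DH}$ (vertical composition strict;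 horizontal composition associative and unital up to natural globular isomorphisms satisfying the pentagon and triangle axioms) with the following data. * Objects are metric hybrid systems and vertical morphisms are hybrid semiconjugacies. * Horizontal morphisms $\overline H\leadsto\underline H$ are directed hybrid systems; the unit of $A$ is the directed system $(A,\mathrm{id},\mathrm{id})$. * Squares from $H$ to $K$ with vertical sides $\overline\alpha\colon\overline H\to\overline K$ and $\underline\alpha\colon\underline H\to\underline K$ are semiconjugacies $\alpha\colon H\to K$ restricting to these, i.e. $\alpha\circ\overline\eta^H=\overline\eta^K\circ\overline\alpha$ and $\alpha\circ\underline\eta^H=\underline\eta^K\circ\underline\alpha$; they compose vertically as semiconjugacies, and the unit square of $f$ is $f$. * For directed systems $H\colon\overline H\leadsto K$ and $H'\colon K\leadsto\underline H'$, the horizontal composite $H'\odot H$ has as graph the pushout of the graph embeddings $\underline\eta^H\colon G(K)\to G(H)$ and $\overline\eta^{H'}\colon G(K)\to G(H')$. All modes, guards and resets of $G(H')$ are those of $H'$; on the remaining vertices and edges they are those of $H$, where resets into modes of $K$ are followed by $\beta_w=\overline\eta^{H'}_w\circ(\underline\eta^H_w)^{-1}$. Its extended metric restricts to those of $H'$ and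 $H$ on the two parts and is $\infty$ between them. There are canonical semiconjugacies $i'\colon H'\to H'\odot H$ (the inclusion) and $i\colon H\to H'\odot H$ ($\beta_w$ on modes of $K$, identity elsewhere), and the initial and final maps are $i\circ\overline\eta^H$ and $i'\circ\underline\eta^{H'}$. With these, $H'\odot H$ is again a directed system; in particular it satisfies the $(\varepsilon,T)$-chain condition. * The horizontal composite of squares $\alpha'\colon H'\to L'$ and $\alpha\colon H\to L$ satisfies $(\alpha'\odot\alpha)\circ i'=i'\circ\alpha'$ and $(\alpha'\odot\alpha)\circ i=i\circ\alpha$. -/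

import Mathlib

open CategoryTheory Set Filter Topology
open scoped Manifold ContDiff ENNReal

universe u w₁ w₂ v₁ u₁

namespace HybridDH

/-! ## Directed graphs, with morphisms that may send edges to vertices -/

/-- A directed graph. -/
structure DirGraph : Type (u + 1) where
  V : Type u
  E : Type u
  src : E → V
  tgt : E → V

namespace DirGraph

/-- The source map on `V ⊔ E`; it is the identity on vertices. -/
def source (G : DirGraph.{u}) : G.V ⊕ G.E → G.V := Sum.elim id G.src

/-- The target map on `V ⊔ E`; it is the identity on vertices. -/
def target (G : DirGraph.{u}) : G.V ⊕ G.E → G.V := Sum.elim id G.tgt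

/-- A graph morphism: vertices go to vertices, edges go to edges or vertices, and sources and
targets are respected. -/
@[ext]
structure Hom (G K : DirGraph.{u}) : Type u where
  onV : G.V → K.V
  onE : G.E → K.V ⊕ K.E
  source_onE : ∀ e, K.source (onE e) = onV (G.src e)
  target_onE : ∀ e, K.target (onE e) = onV (G.tgt e)

/-- The map that a graph morphism induces on `V ⊔ E`. -/
def Hom.onCell {G K : DirGraph.{u}} (f : Hom G K) : G.V ⊕ G.E → K.V ⊕ K.E :=
  Sum.elim (fun v => Sum.inl (f.onV v)) f.onE

theorem Hom.source_onCell {G K : DirGraph.{u}} (f : Hom G K) (c : G.V ⊕ G.E) :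
    K.source (f.onCell c) = f.onV (G.source c) := by
  cases c with
  | inl v => rfl
  | inr e => exact f.source_onE e

theorem Hom.target_onCell {G K : DirGraph.{u}} (f : Hom G K) (c : G.V ⊕ G.E) :
    K.target (f.onCell c) = f.onV (G.target c) := by
  cases c with
  | inl v => rfl
  | inr e => exact f.target_onE e

/-- The identity graph morphism. -/
def Hom.id (G : DirGraph.{u}) : Hom G G where
  onV := fun v => v
  onE := Sum.inr
  source_onE := fun _ => rfl
  target_onE := fun _ => rfl

/-- Composition of graph morphisms. -/
def Hom.comp {G K L : DirGraph.{u}} (f : Hom G K) (g : Hom K L) : Hom G L where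
  onV := fun v => g.onV (f.onV v)
  onE := fun e => g.onCell (f.onE e)
  source_onE := fun e => by rw [g.source_onCell, f.source_onE]
  target_onE := fun e => by rw [g.target_onCell, f.target_onE]

theorem Hom.onCell_comp {G K L : DirGraph.{u}} (f : Hom G K) (g : Hom K L) (c : G.V ⊕ G.E) :
    (f.comp g).onCell c = g.onCell (f.onCell c) := by
  cases c <;> rfl

theorem Hom.onCell_id {G : DirGraph.{u}} (c : G.V ⊕ G.E) : (Hom.id G).onCell c = c := by
  cases c <;> rfl

instance : Category DirGraph.{u} where
  Hom := Hom
  id := Hom.id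
  comp := Hom.comp
  id_comp _ := rfl
  comp_id f := Hom.ext rfl (funext fun e => Hom.onCell_id (f.onE e))
  assoc f g h := Hom.ext rfl (funext fun e => (Hom.onCell_comp g h (f.onE e)).symm)

/-- A morphism is monic precisely if it is injective on vertices and on edges and sends edges to
edges. -/
theorem mono_iff {G K : DirGraph.{u}} (f : G ⟶ K) :
    Mono f ↔ Function.Injective f.onV ∧ Function.Injective f.onE ∧
      ∀ e, ∃ e', f.onE e = Sum.inr e' := by
  constructor
  · intro hf
    have hV : Function.Injective f.onV := by
      intro a b hab
      let P : DirGraph.{u} := ⟨PUnit, PEmpty, PEmpty.elim, PEmpty.elim⟩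
      let x : G.V → (P ⟶ G) := fun v => ⟨fun _ => v, PEmpty.elim, fun e => e.elim, fun e => e.elim⟩
      have h : x a = x b := (cancel_mono f).1
        (Hom.ext (funext fun _ => hab) (funext fun e => e.elim))
      exact congrFun (congrArg Hom.onV h) PUnit.unit
    have key : ∀ c d : G.V ⊕ G.E, G.source c = G.source d → G.target c = G.target d →
        f.onCell c = f.onCell d → c = d := by
      intro c d hs ht hcd
      let Q : DirGraph.{u} := ⟨ULift Bool, PUnit, fun _ => ⟨false⟩, fun _ => ⟨true⟩⟩
      let x : (c : G.V ⊕ G.E) → (Q ⟶ G) := fun c =>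
        ⟨fun b => if b.down then G.target c else G.source c, fun _ => c, fun _ => rfl, fun _ => rfl⟩
      have hx : x c ≫ f = x d ≫ f := by
        refine Hom.ext (funext fun b => ?_) (funext fun _ => hcd)
        show f.onV (if b.down then G.target c else G.source c) =
          f.onV (if b.down then G.target d else G.source d)
        rw [hs, ht]
      exact congrFun (congrArg Hom.onE ((cancel_mono f).1 hx)) PUnit.unit
    refine ⟨hV, ?_, ?_⟩
    · intro a b hab
      have h1 : G.src a = G.src b := hV (by rw [← f.source_onE, ← f.source_onE, hab])
      have h2 : G.tgt a = G.tgt b := hV (by rw [← f.target_onE, ← f.target_onE, hab])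
      exact Sum.inr_injective (key (Sum.inr a) (Sum.inr b) h1 h2 hab)
    · intro e
      rcases h : f.onE e with v | e'
      · have h1 : v = f.onV (G.src e) := by rw [← f.source_onE, h]; rfl
        have h2 : v = f.onV (G.tgt e) := by rw [← f.target_onE, h]; rfl
        have h3 : G.tgt e = G.src e := hV (h2.symm.trans h1)
        have h4 := key (Sum.inr e) (Sum.inl (G.src e)) rfl h3
          (show f.onE e = Sum.inl (f.onV (G.src e)) by rw [h, h1])
        cases h4
      · exact ⟨e', rfl⟩
  · rintro ⟨hV, hE, hI⟩
    refine ⟨fun {Z} g h hgh => Hom.ext (funext fun v => ?_) (funext fun e => ?_)⟩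
    · exact hV (congrFun (congrArg Hom.onV hgh) v)
    · have h0 : f.onCell (g.onE e) = f.onCell (h.onE e) := congrFun (congrArg Hom.onE hgh) e
      rcases hg : g.onE e with a | a <;> rcases hh : h.onE e with b | b <;> rw [hg, hh] at h0
      · exact congrArg Sum.inl (hV (Sum.inl_injective h0))
      · obtain ⟨e', he'⟩ := hI b
        exact absurd (h0.trans he') Sum.inl_ne_inr
      · obtain ⟨e', he'⟩ := hI a
        exact absurd (h0.symm.trans he') Sum.inl_ne_inr
      · exact congrArg Sum.inr (hE h0)

end DirGraph

/-! ## Smooth sets -/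

/-- A smooth manifold without boundary: finite-dimensional, Hausdorff, second countable and
nonempty. -/
structure SmoothMfd : Type (u + 1) where
  pt : Type u
  dim : ℕ
  [top : TopologicalSpace pt]
  [charted : ChartedSpace (EuclideanSpace ℝ (Fin dim)) pt]
  [smooth : IsManifold (𝓡 dim) ∞ pt]
  [t2 : T2Space pt]
  [second : SecondCountableTopology pt]
  [nonempty : Nonempty pt]

attribute [instance] SmoothMfd.top SmoothMfd.charted SmoothMfd.smooth SmoothMfd.t2
  SmoothMfd.second SmoothMfd.nonempty

/-- A smooth set: an arbitrary subset of an ambient manifold. -/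
structure SmoothSet : Type (u + 1) where
  M : SmoothMfd.{u}
  carrier : Set M.pt

namespace SmoothSet

/-- A representative of a smooth map `A → B`: a map of ambient manifolds which is smooth on some
open neighbourhood of `A` and sends `A` into `B`.  Values away from `A` are irrelevant, as
representatives are taken up to germ-equivalence. -/
structure Rep (A B : SmoothSet.{u}) : Type u where
  toFun : A.M.pt → B.M.pt
  smooth : ∀ᶠ x in 𝓝ˢ A.carrier, ContMDiffAt (𝓡 A.M.dim) (𝓡 B.M.dim) ∞ toFun x
  maps : ∀ x ∈ A.carrier, toFun x ∈ B.carrier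

/-- Germ-equivalence: agreement on an open neighbourhood of `A`. -/
instance repSetoid (A B : SmoothSet.{u}) : Setoid (Rep A B) where
  r f g := f.toFun =ᶠ[𝓝ˢ A.carrier] g.toFun
  iseqv := ⟨fun _ => EventuallyEq.rfl, fun h => h.symm, fun h h' => h.trans h'⟩

/-- A smooth map of smooth sets: a germ-equivalence class of representatives. -/
def Map (A B : SmoothSet.{u}) : Type u := Quotient (repSetoid A B)

/-- The identity representative. -/
def Rep.id (A : SmoothSet.{u}) : Rep A A where
  toFun := fun x => x
  smooth := Eventually.of_forall fun _ => contMDiffAt_id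
  maps := fun _ hx => hx

theorem Rep.continuousAt {A B : SmoothSet.{u}} (f : Rep A B) {x : A.M.pt} (hx : x ∈ A.carrier) :
    ContinuousAt f.toFun x :=
  (f.smooth.self_of_nhdsSet x hx).continuousAt

theorem Rep.eventually_comp {A B : SmoothSet.{u}} (f : Rep A B) {p : B.M.pt → Prop}
    (hp : ∀ᶠ y in 𝓝ˢ B.carrier, p y) : ∀ᶠ x in 𝓝ˢ A.carrier, p (f.toFun x) := by
  rw [eventually_nhdsSet_iff_forall] at hp ⊢
  exact fun x hx => (f.continuousAt hx).eventually (hp _ (f.maps x hx))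

/-- Composition of representatives. -/
def Rep.comp {A B C : SmoothSet.{u}} (f : Rep A B) (g : Rep B C) : Rep A C where
  toFun := fun x => g.toFun (f.toFun x)
  smooth := by
    filter_upwards [f.smooth, f.eventually_comp g.smooth] with x hf hg
    exact hg.comp x hf
  maps := fun x hx => g.maps _ (f.maps x hx)

/-- Composition of smooth maps. -/
def Map.comp {A B C : SmoothSet.{u}} : Map A B → Map B C → Map A C :=
  Quotient.map₂ Rep.comp (by
    intro f f' hf g g' hg
    have hf' : f.toFun =ᶠ[𝓝ˢ A.carrier] f'.toFun := hf
    have hg' := f.eventually_comp hg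
    show (f.comp g).toFun =ᶠ[𝓝ˢ A.carrier] (f'.comp g').toFun
    filter_upwards [hf', hg'] with x h1 h2
    show g.toFun (f.toFun x) = g'.toFun (f'.toFun x)
    rw [h2, h1])

instance : Category SmoothSet.{u} where
  Hom := Map
  id A := Quotient.mk _ (Rep.id A)
  comp := Map.comp
  id_comp f := by
    induction f using Quotient.inductionOn with | h f => rfl
  comp_id f := by
    induction f using Quotient.inductionOn with | h f => rfl
  assoc f g h := by
    induction f using Quotient.inductionOn with | h f =>
    induction g using Quotient.inductionOn with | h g =>
    induction h using Quotient.inductionOn with | h h => rfl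

/-- The smooth map represented by `f`. -/
def Rep.germ {A B : SmoothSet.{u}} (f : Rep A B) : A ⟶ B := Quotient.mk (repSetoid A B) f

theorem exists_rep {A B : SmoothSet.{u}} (g : A ⟶ B) : ∃ f : Rep A B, f.germ = g :=
  Quotient.exists_rep g

theorem Rep.germ_eq_iff {A B : SmoothSet.{u}} {f g : Rep A B} :
    f.germ = g.germ ↔ f.toFun =ᶠ[𝓝ˢ A.carrier] g.toFun :=
  Quotient.eq (r := repSetoid A B)

theorem Rep.germ_comp {A B C : SmoothSet.{u}} (f : Rep A B) (g : Rep B C) :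
    (f.comp g).germ = f.germ ≫ g.germ := rfl

theorem Rep.germ_id (A : SmoothSet.{u}) : (Rep.id A).germ = 𝟙 A := rfl

/-- The map of sets underlying a smooth map. -/
def app {A B : SmoothSet.{u}} (g : A ⟶ B) (x : A.carrier) : B.carrier :=
  Quotient.liftOn g (fun f => (⟨f.toFun x, f.maps x x.2⟩ : B.carrier))
    (fun _ _ h => Subtype.ext (EventuallyEq.self_of_nhdsSet h x.2))

theorem app_germ {A B : SmoothSet.{u}} (f : Rep A B) (x : A.carrier) :
    (app f.germ x : B.M.pt) = f.toFun x := rfl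

theorem app_id (A : SmoothSet.{u}) (x : A.carrier) : app (𝟙 A) x = x := rfl

theorem app_comp {A B C : SmoothSet.{u}} (f : A ⟶ B) (g : B ⟶ C) (x : A.carrier) :
    app (f ≫ g) x = app g (app f x) := by
  obtain ⟨f, rfl⟩ := exists_rep f
  obtain ⟨g, rfl⟩ := exists_rep g
  rfl

/-- A smooth map is an embedding if one of its representatives restricts to a smooth embedding
(injective immersion and homeomorphism onto its image) of an open neighbourhood of `A`. -/
def IsEmbedding {A B : SmoothSet.{u}} (g : A ⟶ B) : Prop :=
  ∃ f : Rep A B, f.germ = g ∧ ∃ U : Set A.M.pt, IsOpen U ∧ A.carrier ⊆ U ∧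
    ContMDiffOn (𝓡 A.M.dim) (𝓡 B.M.dim) ∞ f.toFun U ∧
    Topology.IsEmbedding (U.domRestrict f.toFun) ∧
    ∀ x ∈ U, Function.Injective (mfderiv (𝓡 A.M.dim) (𝓡 B.M.dim) f.toFun x)

/-- A smooth map is a diffeomorphism if one of its representatives restricts to a diffeomorphism
from an open neighbourhood of `A` onto an open neighbourhood of `B` that carries `A` onto `B`;
equivalently, if it is an isomorphism of smooth sets. -/
def IsDiffeo {A B : SmoothSet.{u}} (g : A ⟶ B) : Prop := IsIso g

end SmoothSet

/-! ## Hybrid systems and hybrid semiconjugacies -/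

/-- The data of a continuous mode: an active set `carrier` in an ambient manifold `M`, a smooth
vector field `X` on `M` and a flow set `F` inside the active set. -/
structure Mode : Type (u + 1) extends SmoothSet.{u} where
  X : ∀ x : M.pt, TangentSpace (𝓡 M.dim) x
  smooth_X : ContMDiff (𝓡 M.dim) (𝓡 M.dim).tangent ∞
    (fun x => (⟨x, X x⟩ : TangentBundle (𝓡 M.dim) M.pt))
  F : Set M.pt
  F_subset : F ⊆ carrier

/-- `g` maps the flow set of `m` into that of `n`, and restricts there to a smooth semiconjugacy:
`Y ∘ g = Tg ∘ X` on the flow set. -/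
def Mode.IsSemiconj {m n : Mode.{u}} (g : m.toSmoothSet ⟶ n.toSmoothSet) : Prop :=
  ∃ f : SmoothSet.Rep m.toSmoothSet n.toSmoothSet, f.germ = g ∧ ∀ x ∈ m.F,
    f.toFun x ∈ n.F ∧ mfderiv (𝓡 m.M.dim) (𝓡 n.M.dim) f.toFun x (m.X x) = n.X (f.toFun x)

theorem Mode.IsSemiconj.app_mem {m n : Mode.{u}} {g : m.toSmoothSet ⟶ n.toSmoothSet}
    (hg : Mode.IsSemiconj g) (x : m.carrier) (hx : (x : m.M.pt) ∈ m.F) :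
    (SmoothSet.app g x : n.M.pt) ∈ n.F := by
  obtain ⟨f, rfl, hf⟩ := hg
  exact (hf x hx).1

theorem Mode.IsSemiconj.id (m : Mode.{u}) : Mode.IsSemiconj (𝟙 m.toSmoothSet) :=
  ⟨SmoothSet.Rep.id _, rfl, fun x hx => ⟨hx, by
    show mfderiv (𝓡 m.M.dim) (𝓡 m.M.dim) (_root_.id : m.M.pt → m.M.pt) x (m.X x) = m.X x
    rw [mfderiv_id]; rfl⟩⟩

theorem Mode.IsSemiconj.comp {m n k : Mode.{u}} {g : m.toSmoothSet ⟶ n.toSmoothSet}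
    {h : n.toSmoothSet ⟶ k.toSmoothSet} (hg : Mode.IsSemiconj g) (hh : Mode.IsSemiconj h) :
    Mode.IsSemiconj (g ≫ h) := by
  obtain ⟨f, rfl, hf⟩ := hg
  obtain ⟨f', rfl, hf'⟩ := hh
  refine ⟨f.comp f', rfl, fun x hx => ⟨(hf' _ (hf x hx).1).1, ?_⟩⟩
  have h1 := (f.smooth.self_of_nhdsSet x (m.F_subset hx)).mdifferentiableAt (by simp)
  have h2 := (f'.smooth.self_of_nhdsSet _ (n.F_subset (hf x hx).1)).mdifferentiableAt (by simp)
  have h3 := mfderiv_comp_apply x h2 h1 (m.X x)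
  exact h3.trans ((congrArg _ (hf x hx).2).trans (hf' _ (hf x hx).1).2)

/-- The disjoint union of the active sets of a family of modes, with its disjoint union
topology. -/
abbrev TotalSpace {V : Type u} (m : V → Mode.{u}) : Type u := Σ v, (m v).carrier

/-- A hybrid system.  The active set of the mode `v` is identified with the summand `v` of the
hybrid state space, so the guard of an edge `e` is a subset of the summand `src e`, and the reset
map (an arbitrary function) takes values in the summand `tgt e`. -/
structure HybridSystem : Type (u + 1) where
  graph : DirGraph.{u}
  mode : graph.V → Mode.{u}
  guard : graph.E → Set (TotalSpace mode)
  guard_src : ∀ e, ∀ p ∈ guard e, p.1 = graph.src e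
  reset : ∀ e, guard e → TotalSpace mode
  reset_tgt : ∀ e p, (reset e p).1 = graph.tgt e

namespace HybridSystem

/-- The hybrid state space `I(H)`. -/
abbrev State (H : HybridSystem.{u}) : Type u := TotalSpace H.mode

/-- `H.Jump c p q`: the point `p` lies in the guard set of `c` and the reset map of `c` sends `p`
to `q`.  Here a vertex `v` has the flow set `F_v` as guard set and its inclusion as reset map. -/
def Jump (H : HybridSystem.{u}) (c : H.graph.V ⊕ H.graph.E) (p q : H.State) : Prop :=
  match c with
  | Sum.inl v => p.1 = v ∧ (p.2 : (H.mode p.1).M.pt) ∈ (H.mode p.1).F ∧ q = p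
  | Sum.inr e => ∃ h : p ∈ H.guard e, q = H.reset e ⟨p, h⟩

/-- A hybrid semiconjugacy. -/
structure Hom (H K : HybridSystem.{u}) : Type u where
  graph : H.graph ⟶ K.graph
  map : ∀ v, (H.mode v).toSmoothSet ⟶ (K.mode (graph.onV v)).toSmoothSet
  map_flow : ∀ v, Mode.IsSemiconj (map v)
  map_jump : ∀ e (p : H.guard e),
    K.Jump (graph.onE e)
      ⟨graph.onV p.1.1, SmoothSet.app (map p.1.1) p.1.2⟩
      ⟨graph.onV (H.reset e p).1, SmoothSet.app (map (H.reset e p).1) (H.reset e p).2⟩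

/-- The map `I(H) → I(K)` of state spaces induced by a hybrid semiconjugacy. -/
def Hom.onState {H K : HybridSystem.{u}} (f : Hom H K) (p : H.State) : K.State :=
  ⟨f.graph.onV p.1, SmoothSet.app (f.map p.1) p.2⟩

theorem Hom.ext' {H K : HybridSystem.{u}} {f g : Hom H K} (hg : f.graph = g.graph)
    (hm : HEq f.map g.map) : f = g := by
  cases f; cases g
  cases hg
  cases hm
  rfl

theorem Hom.jump {H K : HybridSystem.{u}} (f : Hom H K) {c : H.graph.V ⊕ H.graph.E}
    {p q : H.State} (h : H.Jump c p q) :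
    K.Jump (f.graph.onCell c) (f.onState p) (f.onState q) := by
  cases c with
  | inl v =>
    obtain ⟨rfl, hp, rfl⟩ := h
    exact ⟨rfl, (f.map_flow q.1).app_mem q.2 hp, rfl⟩
  | inr e =>
    obtain ⟨hp, rfl⟩ := h
    exact f.map_jump e ⟨p, hp⟩

/-- The identity semiconjugacy. -/
def Hom.id (H : HybridSystem.{u}) : Hom H H where
  graph := 𝟙 _
  map := fun _ => 𝟙 _
  map_flow := fun _ => Mode.IsSemiconj.id _
  map_jump := fun _ p => ⟨p.2, rfl⟩

/-- Composition of semiconjugacies. -/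
def Hom.comp {H K L : HybridSystem.{u}} (f : Hom H K) (g : Hom K L) : Hom H L where
  graph := f.graph ≫ g.graph
  map := fun v => f.map v ≫ g.map (f.graph.onV v)
  map_flow := fun v => (f.map_flow v).comp (g.map_flow _)
  map_jump := fun e p => by
    have h1 := g.jump (f.map_jump e p)
    have h2 : ∀ q : H.State, (⟨g.graph.onV (f.graph.onV q.1),
        SmoothSet.app (f.map q.1 ≫ g.map (f.graph.onV q.1)) q.2⟩ : L.State) =
        g.onState (f.onState q) :=
      fun q => congrArg (Sigma.mk (g.graph.onV (f.graph.onV q.1))) (SmoothSet.app_comp _ _ _)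
    have h3 := h2 p.1
    have h4 := h2 (H.reset e p)
    exact h3.symm ▸ h4.symm ▸ h1

instance : Category HybridSystem.{u} where
  Hom := Hom
  id := Hom.id
  comp := Hom.comp
  id_comp _ := Hom.ext' (Category.id_comp _) (heq_of_eq (funext fun _ => Category.id_comp _))
  comp_id _ := Hom.ext' (Category.comp_id _) (heq_of_eq (funext fun _ => Category.comp_id _))
  assoc _ _ _ := Hom.ext' (Category.assoc _ _ _)
    (heq_of_eq (funext fun _ => Category.assoc _ _ _))

/-- A hybrid embedding: monic on graphs and an embedding on each active set. -/
structure Hom.IsEmbedding {H K : HybridSystem.{u}} (f : Hom H K) : Prop where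
  mono : Mono f.graph
  embedding : ∀ v, SmoothSet.IsEmbedding (f.map v)

/-- A hybrid embedding identifying `H` with the restriction of `K` to a sink of its graph: on each
active set it is a diffeomorphism, which identifies the flow sets and the guard sets, and every
edge of `K` that starts in the image of the graph of `H` belongs to that image. -/
structure Hom.IsFinal {H K : HybridSystem.{u}} (f : Hom H K) : Prop extends f.IsEmbedding where
  diffeo : ∀ v, SmoothSet.IsDiffeo (f.map v)
  flow : ∀ v (x : (H.mode v).carrier),
    (SmoothSet.app (f.map v) x : (K.mode (f.graph.onV v)).M.pt) ∈ (K.mode (f.graph.onV v)).F →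
      (x : (H.mode v).M.pt) ∈ (H.mode v).F
  guard : ∀ e e', f.graph.onE e = Sum.inr e' → ∀ p, f.onState p ∈ K.guard e' → p ∈ H.guard e
  sink : ∀ e', K.graph.src e' ∈ range f.graph.onV → ∃ e, f.graph.onE e = Sum.inr e'

end HybridSystem

/-- A metric hybrid system: a hybrid system with an extended metric on its state space that induces
the topology of the state space. -/
structure MetricHybridSystem : Type (u + 1) extends HybridSystem.{u} where
  metric : EMetricSpace toHybridSystem.State
  compat : metric.toUniformSpace.toTopologicalSpace =
    (inferInstance : TopologicalSpace toHybridSystem.State)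

/-- The category of metric hybrid systems and hybrid semiconjugacies. -/
instance : Category MetricHybridSystem.{u} where
  Hom H K := HybridSystem.Hom H.toHybridSystem K.toHybridSystem
  id H := HybridSystem.Hom.id H.toHybridSystem
  comp f g := HybridSystem.Hom.comp f g
  id_comp {H K} f := Category.id_comp (X := H.toHybridSystem) (Y := K.toHybridSystem) f
  comp_id {H K} f := Category.comp_id (X := H.toHybridSystem) (Y := K.toHybridSystem) f
  assoc {H K L N} f g h := Category.assoc (W := H.toHybridSystem) (X := K.toHybridSystem)
    (Y := L.toHybridSystem) (Z := N.toHybridSystem) f g h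

/-! ## Chains and directed systems -/

/-- An `(ε, T)`-chain from `x` to `y` in `H`.  Its hybrid time trajectory has an end point, and is
given by the times `0 = τ 0 ≤ ⋯ ≤ τ (n + 1)`, where `n + 1 ≥ 1` is the number of pieces. -/
structure Chain (H : MetricHybridSystem.{u}) (ε T : ℝ) (x y : H.State) where
  n : ℕ
  τ : Fin (n + 2) → ℝ
  τ_zero : τ 0 = 0
  τ_mono : Monotone τ
  /-- the modes of the pieces -/
  ν : Fin (n + 1) → H.graph.V
  /-- the pieces -/
  φ : ∀ j, ℝ → (H.mode (ν j)).M.pt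
  smooth : ∀ j, ∀ᶠ t in 𝓝ˢ (Icc (τ j.castSucc) (τ j.succ)),
    ContMDiffAt 𝓘(ℝ, ℝ) (𝓡 (H.mode (ν j)).M.dim) ∞ (φ j) t
  active : ∀ j, ∀ t ∈ Icc (τ j.castSucc) (τ j.succ), φ j t ∈ (H.mode (ν j)).carrier
  flow : ∀ j, ∀ t ∈ Ico (τ j.castSucc) (τ j.succ), φ j t ∈ (H.mode (ν j)).F
  integral : ∀ j, IsMIntegralCurveOn (I := 𝓡 (H.mode (ν j)).M.dim) (φ j) (H.mode (ν j)).X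
    (Ico (τ j.castSucc) (τ j.succ))
  /-- the edge (reset) or vertex (no reset) used at the `j`th jump time `τ (j + 1)` -/
  jump : Fin n → H.graph.V ⊕ H.graph.E
  source_jump : ∀ j, H.graph.source (jump j) = ν j.castSucc
  target_jump : ∀ j, H.graph.target (jump j) = ν j.succ
  /-- up to an error of at most `ε`, each piece starts where the jump from the end of the previous
  piece leads -/
  jump_le : ∀ j : Fin n, ∃ q : H.State,
    H.Jump (jump j)
      ⟨ν j.castSucc, φ j.castSucc (τ j.castSucc.succ),
        active j.castSucc _ ⟨τ_mono j.castSucc.castSucc_lt_succ.le, le_rfl⟩⟩ q ∧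
    H.metric.edist
      ⟨ν j.succ, φ j.succ (τ j.succ.castSucc),
        active j.succ _ ⟨le_rfl, τ_mono j.succ.castSucc_lt_succ.le⟩⟩ q ≤ ENNReal.ofReal ε
  /-- the jumps without reset are at least `T` apart from each other and from the start -/
  gap_start : ∀ j, (jump j).isLeft → T ≤ τ j.castSucc.succ - τ 0
  gap : ∀ i j, i < j → (jump i).isLeft → (jump j).isLeft →
    T ≤ τ j.castSucc.succ - τ i.castSucc.succ
  start_eq : x = ⟨ν 0, φ 0 (τ 0), active 0 _ ⟨le_rfl, τ_mono (Fin.zero_le _)⟩⟩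
  end_eq : y = ⟨ν (Fin.last n), φ (Fin.last n) (τ (Fin.last (n + 1))),
    active (Fin.last n) _ ⟨τ_mono (Fin.le_last _), le_rfl⟩⟩

/-- A metric hybrid system with semiconjugacies from an initial system `A` and a final system
`B`. -/
structure HybridCospan (A B : MetricHybridSystem.{u}) : Type (u + 1) where
  sys : MetricHybridSystem.{u}
  init : A ⟶ sys
  fin : B ⟶ sys

/-- The conditions for a directed system: the initial map is a hybrid embedding, the final map
identifies the final system with the restriction to a sink, and for all `ε, T > 0` there is an
`(ε, T)`-chain from each point to some point of the final system. -/
structure HybridCospan.IsDirected {A B : MetricHybridSystem.{u}} (M : HybridCospan A B) :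
    Prop where
  init_embedding : HybridSystem.Hom.IsEmbedding M.init
  fin_final : HybridSystem.Hom.IsFinal M.fin
  chain : ∀ ε T : ℝ, 0 < ε → 0 < T → ∀ x : M.sys.State, ∃ y : B.State,
    Nonempty (Chain M.sys ε T x (HybridSystem.Hom.onState M.fin y))

/-- A directed hybrid system from `A` to `B`. -/
structure DirectedHybridSystem (A B : MetricHybridSystem.{u}) : Type (u + 1) extends
    HybridCospan A B where
  directed : toHybridCospan.IsDirected

/-- A square: a semiconjugacy `hom` of the underlying systems which restricts to `f` on the initial
systems and to `g` on the final systems. -/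
structure DirectedSquare {A B A' B' : MetricHybridSystem.{u}} (f : A ⟶ A') (g : B ⟶ B')
    (M : DirectedHybridSystem A B) (N : DirectedHybridSystem A' B') : Type u where
  hom : M.sys ⟶ N.sys
  init_comm : M.init ≫ hom = f ≫ N.init
  fin_comm : M.fin ≫ hom = g ≫ N.fin

/-- The unit: `A` itself, with its identity maps. -/
def unitCospan (A : MetricHybridSystem.{u}) : HybridCospan A A := ⟨A, 𝟙 A, 𝟙 A⟩

/-! ## Sequential composition

Throughout, `κ : B → H` is the final map of the first system `H` and `ι : B → H'` is the initial
map of the second system `H'`.  The composite takes all its data on `H'` from `H'`, and all its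
data outside `H'` from `H`. -/

namespace Glue

open HybridSystem

variable {B H H' : HybridSystem.{u}} (κ : Hom B H) (hκ : κ.IsFinal) (ι : Hom B H')

/-- The vertices of the composite: the pushout of the vertex sets. -/
abbrev Vtx (κ : Hom B H) (H' : HybridSystem.{u}) : Type u :=
  H'.graph.V ⊕ {v : H.graph.V // ¬ ∃ b, κ.graph.onV b = v}

/-- The edges of the composite: the pushout of the edge sets. -/
abbrev Edg (κ : Hom B H) (H' : HybridSystem.{u}) : Type u :=
  H'.graph.E ⊕ {e : H.graph.E // ¬ ∃ b, κ.graph.onE b = Sum.inr e}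

/-- The modes of the composite: those of `H'`, and those of `H` outside `B`. -/
def mode (κ : Hom B H) (H' : HybridSystem.{u}) : Vtx κ H' → Mode.{u} :=
  Sum.elim H'.mode (fun v => H.mode v.1)

theorem onV_injective {κ : Hom B H} (hκ : κ.IsFinal) : Function.Injective κ.graph.onV :=
  ((DirGraph.mono_iff _).1 hκ.mono).1

theorem onE_injective {κ : Hom B H} (hκ : κ.IsFinal) : Function.Injective κ.graph.onE :=
  ((DirGraph.mono_iff _).1 hκ.mono).2.1

/-- The mode `κ b` of `H` is sent to the mode `ι b` of `H'`, by the smooth map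
`β_b = ι_b ∘ κ_b⁻¹`. -/
noncomputable def overlap {κ : Hom B H} (hκ : κ.IsFinal) (ι : Hom B H') (b : B.graph.V) :
    Σ w : Vtx κ H', (H.mode (κ.graph.onV b)).toSmoothSet ⟶ (mode κ H' w).toSmoothSet :=
  haveI : IsIso (κ.map b) := hκ.diffeo b
  ⟨Sum.inl (ι.graph.onV b), inv (κ.map b) ≫ ι.map b⟩

open Classical in
/-- The map of modes from `H` to the composite: `β` on the overlap `B`, and the identity
elsewhere. -/
noncomputable def ofMode {κ : Hom B H} (hκ : κ.IsFinal) (ι : Hom B H') (v : H.graph.V) :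
    Σ w : Vtx κ H', (H.mode v).toSmoothSet ⟶ (mode κ H' w).toSmoothSet :=
  if h : ∃ b, κ.graph.onV b = v then h.choose_spec ▸ overlap hκ ι h.choose
  else ⟨Sum.inr ⟨v, h⟩, 𝟙 (H.mode v).toSmoothSet⟩

theorem ofMode_onV {κ : Hom B H} (hκ : κ.IsFinal) (ι : Hom B H') (b : B.graph.V) :
    ofMode hκ ι (κ.graph.onV b) = overlap hκ ι b := by
  have key : ∀ (b' : B.graph.V) (h : κ.graph.onV b' = κ.graph.onV b),
      (h ▸ overlap hκ ι b' : Σ w : Vtx κ H',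
        (H.mode (κ.graph.onV b)).toSmoothSet ⟶ (mode κ H' w).toSmoothSet) = overlap hκ ι b := by
    intro b' h
    obtain rfl := onV_injective hκ h
    rfl
  have h : ∃ b', κ.graph.onV b' = κ.graph.onV b := ⟨b, rfl⟩
  rw [ofMode, dif_pos h]
  exact key _ _

theorem ofMode_of_not {κ : Hom B H} (hκ : κ.IsFinal) (ι : Hom B H') (v : H.graph.V)
    (h : ¬ ∃ b, κ.graph.onV b = v) :
    ofMode hκ ι v = ⟨Sum.inr ⟨v, h⟩, 𝟙 (H.mode v).toSmoothSet⟩ := by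
  rw [ofMode, dif_neg h]

theorem src_not {κ : Hom B H} (hκ : κ.IsFinal) (e : H.graph.E)
    (h : ¬ ∃ b, κ.graph.onE b = Sum.inr e) : ¬ ∃ b, κ.graph.onV b = H.graph.src e :=
  fun hb => h (hκ.sink e hb)

/-- The graph of the composite. -/
noncomputable def graph {κ : Hom B H} (hκ : κ.IsFinal) (ι : Hom B H') : DirGraph.{u} where
  V := Vtx κ H'
  E := Edg κ H'
  src := Sum.elim (fun e => Sum.inl (H'.graph.src e))
    (fun e => Sum.inr ⟨H.graph.src e.1, src_not hκ e.1 e.2⟩)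
  tgt := Sum.elim (fun e => Sum.inl (H'.graph.tgt e)) (fun e => (ofMode hκ ι (H.graph.tgt e.1)).1)

/-- The inclusion of the state space of `H'` into that of the composite. -/
def stateInl (κ : Hom B H) (p : H'.State) : TotalSpace (mode κ H') := ⟨Sum.inl p.1, p.2⟩

/-- The map from the state space of `H` to that of the composite. -/
noncomputable def stateInr {κ : Hom B H} (hκ : κ.IsFinal) (ι : Hom B H') (p : H.State) :
    TotalSpace (mode κ H') :=
  ⟨(ofMode hκ ι p.1).1, SmoothSet.app (ofMode hκ ι p.1).2 p.2⟩

/-- The guards of the composite: the guards of `H'`, and those of `H` outside `B`. -/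
def guard (κ : Hom B H) (H' : HybridSystem.{u}) : Edg κ H' → Set (TotalSpace (mode κ H'))
  | Sum.inl e => fun p => match p with
    | ⟨Sum.inl v, x⟩ => (⟨v, x⟩ : H'.State) ∈ H'.guard e
    | ⟨Sum.inr _, _⟩ => False
  | Sum.inr e => fun p => match p with
    | ⟨Sum.inl _, _⟩ => False
    | ⟨Sum.inr v, x⟩ => (⟨v.1, x⟩ : H.State) ∈ H.guard e.1

/-- The resets of the composite: those of `H'`, and those of `H` outside `B`, followed by `β` if
they lead into `B`. -/
noncomputable def reset {κ : Hom B H} (hκ : κ.IsFinal) (ι : Hom B H') :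
    ∀ e : Edg κ H', guard κ H' e → TotalSpace (mode κ H')
  | Sum.inl e, ⟨⟨Sum.inl v, x⟩, h⟩ => stateInl κ (H'.reset e ⟨⟨v, x⟩, h⟩)
  | Sum.inl _, ⟨⟨Sum.inr _, _⟩, h⟩ => h.elim
  | Sum.inr _, ⟨⟨Sum.inl _, _⟩, h⟩ => h.elim
  | Sum.inr e, ⟨⟨Sum.inr v, x⟩, h⟩ => stateInr hκ ι (H.reset e.1 ⟨⟨v.1, x⟩, h⟩)

/-- The composite hybrid system. -/
noncomputable def system {κ : Hom B H} (hκ : κ.IsFinal) (ι : Hom B H') : HybridSystem.{u} where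
  graph := graph hκ ι
  mode := mode κ H'
  guard := guard κ H'
  guard_src
    | Sum.inl e, ⟨Sum.inl v, x⟩, h => congrArg Sum.inl (H'.guard_src e ⟨v, x⟩ h)
    | Sum.inl _, ⟨Sum.inr _, _⟩, h => h.elim
    | Sum.inr _, ⟨Sum.inl _, _⟩, h => h.elim
    | Sum.inr e, ⟨Sum.inr v, x⟩, h =>
      congrArg Sum.inr (Subtype.ext (H.guard_src e.1 ⟨v.1, x⟩ h))
  reset := reset hκ ι
  reset_tgt
    | Sum.inl e, ⟨⟨Sum.inl v, x⟩, h⟩ => congrArg Sum.inl (H'.reset_tgt e ⟨⟨v, x⟩, h⟩)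
    | Sum.inl _, ⟨⟨Sum.inr _, _⟩, h⟩ => h.elim
    | Sum.inr _, ⟨⟨Sum.inl _, _⟩, h⟩ => h.elim
    | Sum.inr e, ⟨⟨Sum.inr v, x⟩, h⟩ =>
      congrArg (fun v => (ofMode hκ ι v).1) (H.reset_tgt e.1 ⟨⟨v.1, x⟩, h⟩)

/-- The inclusion of `H'` into the composite. -/
noncomputable def inl {κ : Hom B H} (hκ : κ.IsFinal) (ι : Hom B H') : Hom H' (system hκ ι) where
  graph :=
    { onV := Sum.inl
      onE := fun e => Sum.inr (Sum.inl e)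
      source_onE := fun _ => rfl
      target_onE := fun _ => rfl }
  map := fun v => 𝟙 (H'.mode v).toSmoothSet
  map_flow := fun v => Mode.IsSemiconj.id (H'.mode v)
  map_jump := fun _ p => ⟨p.2, rfl⟩

theorem app_inv {A A' : SmoothSet.{u}} (g : A ⟶ A') [IsIso g] (x : A'.carrier) :
    SmoothSet.app g (SmoothSet.app (inv g) x) = x := by
  rw [← SmoothSet.app_comp, IsIso.inv_hom_id, SmoothSet.app_id]

theorem app_inv' {A A' : SmoothSet.{u}} (g : A ⟶ A') [IsIso g] (x : A.carrier) :
    SmoothSet.app (inv g) (SmoothSet.app g x) = x := by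
  rw [← SmoothSet.app_comp, IsIso.hom_inv_id, SmoothSet.app_id]

theorem isSemiconj_inv {m n : Mode.{u}} {g : m.toSmoothSet ⟶ n.toSmoothSet} [IsIso g]
    (hg : Mode.IsSemiconj g)
    (hF : ∀ x : m.carrier, (SmoothSet.app g x : n.M.pt) ∈ n.F → (x : m.M.pt) ∈ m.F) :
    Mode.IsSemiconj (inv g) := by
  obtain ⟨f, hfg, hf⟩ := hg
  obtain ⟨k, hk⟩ := SmoothSet.exists_rep (inv g)
  have hkf : (k.comp f).germ = (SmoothSet.Rep.id _).germ := by
    rw [SmoothSet.Rep.germ_comp, hfg, hk, IsIso.inv_hom_id, SmoothSet.Rep.germ_id]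
  have hfk : (f.comp k).germ = (SmoothSet.Rep.id _).germ := by
    rw [SmoothSet.Rep.germ_comp, hfg, hk, IsIso.hom_inv_id, SmoothSet.Rep.germ_id]
  rw [SmoothSet.Rep.germ_eq_iff] at hkf hfk
  refine ⟨k, hk, fun y hy => ?_⟩
  have hy' := n.F_subset hy
  have hfky : f.toFun (k.toFun y) = y := hkf.self_of_nhdsSet hy'
  have hky : k.toFun y ∈ m.F := by
    refine hF ⟨k.toFun y, k.maps y hy'⟩ ?_
    rw [← hfg, SmoothSet.app_germ]
    show f.toFun (k.toFun y) ∈ n.F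
    rwa [hfky]
  refine ⟨hky, ?_⟩
  have h1 : MDifferentiableAt (𝓡 m.M.dim) (𝓡 n.M.dim) f.toFun (k.toFun y) :=
    (f.smooth.self_of_nhdsSet _ (m.F_subset hky)).mdifferentiableAt (by simp)
  have h2 : MDifferentiableAt (𝓡 n.M.dim) (𝓡 m.M.dim) k.toFun y :=
    (k.smooth.self_of_nhdsSet _ hy').mdifferentiableAt (by simp)
  obtain ⟨x, hx⟩ : ∃ x, x = k.toFun y := ⟨_, rfl⟩
  rw [← hx] at h1 hfky hky
  subst hfky
  have h3 := mfderiv_comp_apply x h2 h1 (m.X x)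
  have h5 : (k.toFun ∘ f.toFun) =ᶠ[𝓝 x] id :=
    (eventually_nhdsSet_iff_forall.1 hfk) x (m.F_subset hky)
  have h6 : HasMFDerivAt (𝓡 m.M.dim) (𝓡 m.M.dim) (k.toFun ∘ f.toFun) x
      (ContinuousLinearMap.id ℝ (TangentSpace (𝓡 m.M.dim) x)) :=
    (hasMFDerivAt_id x).congr_of_eventuallyEq h5
  have h7 : (mfderiv (𝓡 m.M.dim) (𝓡 m.M.dim) (k.toFun ∘ f.toFun) x (m.X x) :
      EuclideanSpace ℝ (Fin m.M.dim)) = m.X x :=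
    congrArg (fun L : EuclideanSpace ℝ (Fin m.M.dim) →L[ℝ] EuclideanSpace ℝ (Fin m.M.dim) =>
      L (m.X x)) h6.mfderiv
  have h8 : (m.X x : EuclideanSpace ℝ (Fin m.M.dim)) = m.X (k.toFun (f.toFun x)) :=
    congrArg (fun z => (m.X z : EuclideanSpace ℝ (Fin m.M.dim))) hx
  have h9 := congrArg (mfderiv (𝓡 n.M.dim) (𝓡 m.M.dim) k.toFun (f.toFun x)) (hf x hky).2
  exact h9.symm.trans (h3.symm.trans (h7.trans h8))

theorem isSemiconj_ofMode {κ : Hom B H} (hκ : κ.IsFinal) (ι : Hom B H') (v : H.graph.V) :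
    Mode.IsSemiconj (m := H.mode v) (n := mode κ H' (ofMode hκ ι v).1) (ofMode hκ ι v).2 := by
  by_cases h : ∃ b, κ.graph.onV b = v
  · obtain ⟨b, rfl⟩ := h
    rw [ofMode_onV]
    have : IsIso (κ.map b) := hκ.diffeo b
    exact (isSemiconj_inv (κ.map_flow b) (hκ.flow b)).comp (ι.map_flow b)
  · rw [ofMode_of_not hκ ι v h]
    exact Mode.IsSemiconj.id (H.mode v)

theorem stateInr_onState {κ : Hom B H} (hκ : κ.IsFinal) (ι : Hom B H') (p : B.State) :
    stateInr hκ ι (κ.onState p) = stateInl κ (ι.onState p) := by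
  have : IsIso (κ.map p.1) := hκ.diffeo p.1
  have h1 : stateInr hκ ι (κ.onState p) = ⟨(overlap hκ ι p.1).1,
      SmoothSet.app (overlap hκ ι p.1).2 (SmoothSet.app (κ.map p.1) p.2)⟩ :=
    congrArg (fun w : Σ w : Vtx κ H', (H.mode (κ.graph.onV p.1)).toSmoothSet ⟶
        (mode κ H' w).toSmoothSet =>
      (⟨w.1, SmoothSet.app w.2 (SmoothSet.app (κ.map p.1) p.2)⟩ : TotalSpace (mode κ H')))
      (ofMode_onV hκ ι p.1)
  refine h1.trans (congrArg (Sigma.mk (Sum.inl (ι.graph.onV p.1))) ?_)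
  refine (SmoothSet.app_comp (inv (κ.map p.1)) (ι.map p.1) _).trans ?_
  rw [app_inv']
  rfl

/-- Every point of a mode in the overlap comes from `B`. -/
theorem exists_onState {κ : Hom B H} (hκ : κ.IsFinal) (p : H.State)
    (h : ∃ b, κ.graph.onV b = p.1) : ∃ q : B.State, κ.onState q = p := by
  obtain ⟨v, x⟩ := p
  obtain ⟨b, rfl⟩ := h
  have : IsIso (κ.map b) := hκ.diffeo b
  exact ⟨⟨b, SmoothSet.app (inv (κ.map b)) x⟩,
    congrArg (Sigma.mk (κ.graph.onV b)) (app_inv (κ.map b) x)⟩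

open Classical in
/-- The map of edges from `H` to the composite. -/
noncomputable def ofEdge {κ : Hom B H} (ι : Hom B H') (e : H.graph.E) : Vtx κ H' ⊕ Edg κ H' :=
  if h : ∃ b, κ.graph.onE b = Sum.inr e then
    Sum.map Sum.inl Sum.inl (ι.graph.onE h.choose)
  else Sum.inr (Sum.inr ⟨e, h⟩)

theorem ofEdge_onE {κ : Hom B H} (hκ : κ.IsFinal) (ι : Hom B H') (b : B.graph.E)
    (e : H.graph.E) (he : κ.graph.onE b = Sum.inr e) :
    ofEdge (κ := κ) ι e = (inl hκ ι).graph.onCell (ι.graph.onE b) := by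
  have h : ∃ b, κ.graph.onE b = Sum.inr e := ⟨b, he⟩
  have hb : h.choose = b := onE_injective hκ (h.choose_spec.trans he.symm)
  rw [ofEdge, dif_pos h, hb]
  rcases ι.graph.onE b with v | e' <;> rfl

theorem ofEdge_of_not {κ : Hom B H} (ι : Hom B H') (e : H.graph.E)
    (h : ¬ ∃ b, κ.graph.onE b = Sum.inr e) :
    ofEdge (κ := κ) ι e = Sum.inr (Sum.inr ⟨e, h⟩) := by
  rw [ofEdge, dif_neg h]

theorem ofMode_fst {κ : Hom B H} (hκ : κ.IsFinal) (ι : Hom B H') (b : B.graph.V) :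
    (ofMode hκ ι (κ.graph.onV b)).1 = Sum.inl (ι.graph.onV b) :=
  congrArg Sigma.fst (ofMode_onV hκ ι b)

/-- The semiconjugacy from `H` to the composite: `β` on the overlap, the identity elsewhere. -/
noncomputable def inr {κ : Hom B H} (hκ : κ.IsFinal) (ι : Hom B H') : Hom H (system hκ ι) where
  graph :=
    { onV := fun v => (ofMode hκ ι v).1
      onE := ofEdge ι
      source_onE := fun e => by
        by_cases h : ∃ b, κ.graph.onE b = Sum.inr e
        · obtain ⟨b, hb⟩ := h
          have h1 : H.graph.src e = κ.graph.onV (B.graph.src b) := by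
            rw [← κ.graph.source_onE, hb]; rfl
          rw [ofEdge_onE hκ ι b e hb, h1, ofMode_fst]
          exact ((inl hκ ι).graph.source_onCell _).trans (congrArg _ (ι.graph.source_onE b))
        · rw [ofEdge_of_not ι e h, ofMode_of_not hκ ι _ (src_not hκ e h)]
          rfl
      target_onE := fun e => by
        by_cases h : ∃ b, κ.graph.onE b = Sum.inr e
        · obtain ⟨b, hb⟩ := h
          have h1 : H.graph.tgt e = κ.graph.onV (B.graph.tgt b) := by
            rw [← κ.graph.target_onE, hb]; rfl
          rw [ofEdge_onE hκ ι b e hb, h1, ofMode_fst]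
          exact ((inl hκ ι).graph.target_onCell _).trans (congrArg _ (ι.graph.target_onE b))
        · rw [ofEdge_of_not ι e h]
          rfl }
  map := fun v => (ofMode hκ ι v).2
  map_flow := fun v => isSemiconj_ofMode hκ ι v
  map_jump := fun e p => by
    show (system hκ ι).Jump (ofEdge ι e) (stateInr hκ ι p.1) (stateInr hκ ι (H.reset e p))
    by_cases h : ∃ b, κ.graph.onE b = Sum.inr e
    · obtain ⟨b, hb⟩ := h
      have h1 : H.graph.src e = κ.graph.onV (B.graph.src b) := by
        rw [← κ.graph.source_onE, hb]; rfl
      obtain ⟨q, hq⟩ := exists_onState hκ p.1 ⟨B.graph.src b, by rw [H.guard_src e _ p.2, h1]⟩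
      have hqb : q ∈ B.guard b := hκ.guard b e hb q (by rw [hq]; exact p.2)
      have h2 := κ.map_jump b ⟨q, hqb⟩
      rw [hb] at h2
      obtain ⟨h3, h4⟩ := h2
      have h5 : H.reset e p = κ.onState (B.reset b ⟨q, hqb⟩) := by
        refine Eq.trans ?_ h4.symm
        exact congrArg (H.reset e) (Subtype.ext hq.symm)
      rw [h5, ← hq, stateInr_onState, stateInr_onState, ofEdge_onE hκ ι b e hb]
      exact (inl hκ ι).jump (ι.map_jump b ⟨q, hqb⟩)
    · rw [ofEdge_of_not ι e h]
      obtain ⟨⟨v, x⟩, hp⟩ := p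
      have hv : ¬ ∃ b, κ.graph.onV b = v := by
        have := H.guard_src e _ hp
        intro hb
        exact src_not hκ e h (by rw [← this]; exact hb)
      have h6 : stateInr hκ ι ⟨v, x⟩ = ⟨Sum.inr ⟨v, hv⟩, x⟩ :=
        congrArg (fun w : Σ w : Vtx κ H', (H.mode v).toSmoothSet ⟶ (mode κ H' w).toSmoothSet =>
          (⟨w.1, SmoothSet.app w.2 x⟩ : TotalSpace (mode κ H'))) (ofMode_of_not hκ ι v hv)
      rw [h6]
      exact ⟨hp, rfl⟩

end Glue

namespace Glue

open HybridSystem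

variable {B : HybridSystem.{u}} {H H' : MetricHybridSystem.{u}}

/-- The extended distance on the composite: that of `H'` on the modes of `H'`, that of `H` on the
modes of `H` outside `B`, and `∞` between the two parts. -/
def dist (κ : Hom B H.toHybridSystem) (H' : MetricHybridSystem.{u}) :
    TotalSpace (mode κ H'.toHybridSystem) → TotalSpace (mode κ H'.toHybridSystem) → ℝ≥0∞
  | ⟨Sum.inl v, x⟩, ⟨Sum.inl w, y⟩ => H'.metric.edist ⟨v, x⟩ ⟨w, y⟩
  | ⟨Sum.inr v, x⟩, ⟨Sum.inr w, y⟩ => H.metric.edist ⟨v.1, x⟩ ⟨w.1, y⟩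
  | ⟨Sum.inl _, _⟩, ⟨Sum.inr _, _⟩ => ⊤
  | ⟨Sum.inr _, _⟩, ⟨Sum.inl _, _⟩ => ⊤

/-- The extended metric on the composite. -/
@[reducible]
noncomputable def metric (κ : Hom B H.toHybridSystem) (H' : MetricHybridSystem.{u}) :
    EMetricSpace (TotalSpace (mode κ H'.toHybridSystem)) where
  edist := dist κ H'
  edist_self
    | ⟨Sum.inl v, x⟩ => H'.metric.edist_self ⟨v, x⟩
    | ⟨Sum.inr v, x⟩ => H.metric.edist_self ⟨v.1, x⟩
  edist_comm
    | ⟨Sum.inl v, x⟩, ⟨Sum.inl w, y⟩ => H'.metric.edist_comm ⟨v, x⟩ ⟨w, y⟩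
    | ⟨Sum.inr v, x⟩, ⟨Sum.inr w, y⟩ => H.metric.edist_comm ⟨v.1, x⟩ ⟨w.1, y⟩
    | ⟨Sum.inl _, _⟩, ⟨Sum.inr _, _⟩ => rfl
    | ⟨Sum.inr _, _⟩, ⟨Sum.inl _, _⟩ => rfl
  edist_triangle
    | ⟨Sum.inl v, x⟩, ⟨Sum.inl w, y⟩, ⟨Sum.inl z, t⟩ =>
      H'.metric.edist_triangle ⟨v, x⟩ ⟨w, y⟩ ⟨z, t⟩
    | ⟨Sum.inr v, x⟩, ⟨Sum.inr w, y⟩, ⟨Sum.inr z, t⟩ =>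
      H.metric.edist_triangle ⟨v.1, x⟩ ⟨w.1, y⟩ ⟨z.1, t⟩
    | ⟨Sum.inl _, _⟩, ⟨Sum.inr _, _⟩, ⟨Sum.inl _, _⟩ => le_of_le_of_eq le_top (top_add _).symm
    | ⟨Sum.inl _, _⟩, ⟨Sum.inl _, _⟩, ⟨Sum.inr _, _⟩ => le_of_le_of_eq le_top (add_top _).symm
    | ⟨Sum.inl _, _⟩, ⟨Sum.inr _, _⟩, ⟨Sum.inr _, _⟩ => le_of_le_of_eq le_top (top_add _).symm
    | ⟨Sum.inr _, _⟩, ⟨Sum.inr _, _⟩, ⟨Sum.inl _, _⟩ => le_of_le_of_eq le_top (add_top _).symm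
    | ⟨Sum.inr _, _⟩, ⟨Sum.inl _, _⟩, ⟨Sum.inl _, _⟩ => le_of_le_of_eq le_top (top_add _).symm
    | ⟨Sum.inr _, _⟩, ⟨Sum.inl _, _⟩, ⟨Sum.inr _, _⟩ => le_of_le_of_eq le_top (top_add _).symm
  eq_of_edist_eq_zero {p q} h := by
    obtain ⟨v | v, x⟩ := p <;> obtain ⟨w | w, y⟩ := q
    · exact congrArg (stateInl κ) (H'.metric.eq_of_edist_eq_zero (x := ⟨v, x⟩) (y := ⟨w, y⟩) h)
    · exact absurd h ENNReal.top_ne_zero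
    · exact absurd h ENNReal.top_ne_zero
    · have h1 : (⟨v.1, x⟩ : H.State) = ⟨w.1, y⟩ := H.metric.eq_of_edist_eq_zero h
      obtain ⟨v, hv⟩ := v
      obtain ⟨w, hw⟩ := w
      cases h1
      rfl

theorem isOpen_state_iff (H : MetricHybridSystem.{u}) (s : Set H.State) :
    IsOpen s ↔ ∀ p ∈ s, ∃ ε > 0, ∀ q, H.metric.edist q p < ε → q ∈ s := by
  have h : IsOpen s ↔ IsOpen[H.metric.toUniformSpace.toTopologicalSpace] s := by rw [H.compat]
  exact h.trans (@EMetric.isOpen_iff _ H.metric.toPseudoEMetricSpace s)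

theorem metric_compat (κ : Hom B H.toHybridSystem) (H' : MetricHybridSystem.{u}) :
    (metric κ H').toUniformSpace.toTopologicalSpace =
      (inferInstance : TopologicalSpace (TotalSpace (mode κ H'.toHybridSystem))) := by
  refine TopologicalSpace.ext_iff.2 fun s => ?_
  have h0 : IsOpen[(metric κ H').toUniformSpace.toTopologicalSpace] s ↔
      ∀ p ∈ s, ∃ ε > 0, ∀ q, dist κ H' q p < ε → q ∈ s := by
    exact @EMetric.isOpen_iff _ (metric κ H').toPseudoEMetricSpace s
  rw [h0]
  let t : Set H.State := fun p =>
    ∃ h : ¬ ∃ b, κ.graph.onV b = p.1, (⟨Sum.inr ⟨p.1, h⟩, p.2⟩ : TotalSpace (mode κ H'.1)) ∈ s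
  constructor
  · intro h
    rw [isOpen_sigma_iff]
    rintro (v | v)
    · have h1 : IsOpen ((stateInl κ : H'.State → _) ⁻¹' s) := by
        rw [isOpen_state_iff]
        intro p hp
        obtain ⟨ε, hε, h2⟩ := h _ hp
        exact ⟨ε, hε, fun q hq => h2 (stateInl κ q) hq⟩
      exact isOpen_sigma_iff.1 h1 v
    · have h1 : IsOpen t := by
        rw [isOpen_state_iff]
        rintro p ⟨hp, hps⟩
        have hN : IsOpen {p : H.State | ¬ ∃ b, κ.graph.onV b = p.1} := by
          rw [isOpen_sigma_iff]
          exact fun i => isOpen_const (p := ¬ ∃ b, κ.graph.onV b = i)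
        obtain ⟨ε, hε, h2⟩ := h _ hps
        obtain ⟨δ, hδ, h3⟩ := (isOpen_state_iff H _).1 hN p hp
        refine ⟨min ε δ, lt_min hε hδ, fun q hq => ?_⟩
        have hqN := h3 q (lt_of_lt_of_le hq (min_le_right _ _))
        exact ⟨hqN, h2 ⟨Sum.inr ⟨q.1, hqN⟩, q.2⟩ (lt_of_lt_of_le hq (min_le_left _ _))⟩
      have h2 := isOpen_sigma_iff.1 h1 v.1
      have h3 : Sigma.mk v.1 ⁻¹' t = Sigma.mk (Sum.inr v) ⁻¹' s :=
        Set.ext fun x => ⟨fun hx => hx.2, fun hx => ⟨v.2, hx⟩⟩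
      exact h3 ▸ h2
  · rintro h ⟨v | v, x⟩ hx
    · have h1 : IsOpen ((stateInl κ : H'.State → _) ⁻¹' s) :=
        isOpen_sigma_iff.2 fun i => isOpen_sigma_iff.1 h (Sum.inl i)
      obtain ⟨ε, hε, h2⟩ := (isOpen_state_iff H' _).1 h1 ⟨v, x⟩ hx
      refine ⟨ε, hε, ?_⟩
      rintro ⟨w | w, y⟩ hy
      · exact h2 ⟨w, y⟩ hy
      · exact absurd hy not_top_lt
    · have h1 : IsOpen t := by
        rw [isOpen_sigma_iff]
        intro i
        by_cases hi : ∃ b, κ.graph.onV b = i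
        · have : Sigma.mk i ⁻¹' t = ∅ := Set.eq_empty_of_forall_notMem fun _ hx => hx.1 hi
          rw [this]
          exact isOpen_empty
        · have h3 : Sigma.mk i ⁻¹' t = Sigma.mk (Sum.inr ⟨i, hi⟩) ⁻¹' s :=
            Set.ext fun x => ⟨fun hx => hx.2, fun hx => ⟨hi, hx⟩⟩
          exact h3 ▸ isOpen_sigma_iff.1 h (Sum.inr ⟨i, hi⟩)
      obtain ⟨ε, hε, h2⟩ := (isOpen_state_iff H _).1 h1 ⟨v.1, x⟩ ⟨v.2, hx⟩
      refine ⟨ε, hε, ?_⟩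
      rintro ⟨w | w, y⟩ hy
      · exact absurd hy not_top_lt
      · exact (h2 ⟨w.1, y⟩ hy).2

end Glue

section Composite

variable {A B C : MetricHybridSystem.{u}}

/-- The underlying metric hybrid system of the sequential composition `M ⊙ N` ("first `N`, then
`M`"). -/
noncomputable def compSystem (M : DirectedHybridSystem B C) (N : DirectedHybridSystem A B) :
    MetricHybridSystem.{u} where
  toHybridSystem := Glue.system N.directed.fin_final M.init
  metric := Glue.metric N.fin M.sys
  compat := Glue.metric_compat N.fin M.sys

/-- The canonical semiconjugacy from the second system to the composite. -/
noncomputable def compInl (M : DirectedHybridSystem B C) (N : DirectedHybridSystem A B) :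
    M.sys ⟶ compSystem M N :=
  Glue.inl N.directed.fin_final M.init

/-- The canonical semiconjugacy from the first system to the composite. -/
noncomputable def compInr (M : DirectedHybridSystem B C) (N : DirectedHybridSystem A B) :
    N.sys ⟶ compSystem M N :=
  Glue.inr N.directed.fin_final M.init

/-- The sequential composition `M ⊙ N`, with its initial and final maps. -/
noncomputable def compCospan (M : DirectedHybridSystem B C) (N : DirectedHybridSystem A B) :
    HybridCospan A C where
  sys := compSystem M N
  init := N.init ≫ compInr M N
  fin := M.fin ≫ compInl M N

end Composite

/-! ## Pseudo double categories -/

/-- A (pseudo) double category with category of objects and vertical morphisms `C`, horizontal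
morphisms `Hor`, squares `Sq`, horizontal units `unit` and horizontal composition `hcomp` of
horizontal morphisms.  The square type `Sq f g M N` has vertical source `M`, vertical target `N`,
and left and right boundary `f` and `g`.  Vertical composition is strict.  Squares whose boundaries
are equal only by the laws of the category `C` are compared by heterogeneous equality. -/
structure PseudoDoubleCategory (C : Type u₁) [Category.{v₁} C] (Hor : C → C → Type w₁)
    (Sq : ∀ {A B A' B' : C}, (A ⟶ A') → (B ⟶ B') → Hor A B → Hor A' B' → Type w₂)
    (unit : ∀ A : C, Hor A A) (hcomp : ∀ {A B D : C}, Hor B D → Hor A B → Hor A D) where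
  /-- vertical identities -/
  vid : ∀ {A B : C} (M : Hor A B), Sq (𝟙 A) (𝟙 B) M M
  /-- vertical composition of squares -/
  vcomp : ∀ {A B A' B' A'' B'' : C} {f : A ⟶ A'} {g : B ⟶ B'} {f' : A' ⟶ A''} {g' : B' ⟶ B''}
    {M : Hor A B} {N : Hor A' B'} {P : Hor A'' B''},
    Sq f g M N → Sq f' g' N P → Sq (f ≫ f') (g ≫ g') M P
  vid_vcomp : ∀ {A B A' B' : C} {f : A ⟶ A'} {g : B ⟶ B'} {M : Hor A B} {N : Hor A' B'}
    (s : Sq f g M N), HEq (vcomp (vid M) s) s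
  vcomp_vid : ∀ {A B A' B' : C} {f : A ⟶ A'} {g : B ⟶ B'} {M : Hor A B} {N : Hor A' B'}
    (s : Sq f g M N), HEq (vcomp s (vid N)) s
  vcomp_assoc : ∀ {A B A' B' A'' B'' A₃ B₃ : C} {f : A ⟶ A'} {g : B ⟶ B'} {f' : A' ⟶ A''}
    {g' : B' ⟶ B''} {f'' : A'' ⟶ A₃} {g'' : B'' ⟶ B₃} {M : Hor A B} {N : Hor A' B'}
    {P : Hor A'' B''} {Q : Hor A₃ B₃} (s : Sq f g M N) (t : Sq f' g' N P) (r : Sq f'' g'' P Q),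
    HEq (vcomp (vcomp s t) r) (vcomp s (vcomp t r))
  /-- the unit functor on vertical morphisms -/
  unitSq : ∀ {A A' : C} (f : A ⟶ A'), Sq f f (unit A) (unit A')
  unitSq_id : ∀ A : C, unitSq (𝟙 A) = vid (unit A)
  unitSq_comp : ∀ {A A' A'' : C} (f : A ⟶ A') (g : A' ⟶ A''),
    unitSq (f ≫ g) = vcomp (unitSq f) (unitSq g)
  /-- horizontal composition of squares -/
  hcompSq : ∀ {A B D A' B' D' : C} {f : A ⟶ A'} {g : B ⟶ B'} {h : D ⟶ D'}
    {M : Hor B D} {M' : Hor B' D'} {N : Hor A B} {N' : Hor A' B'},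
    Sq g h M M' → Sq f g N N' → Sq f h (hcomp M N) (hcomp M' N')
  hcompSq_vid : ∀ {A B D : C} (M : Hor B D) (N : Hor A B),
    hcompSq (vid M) (vid N) = vid (hcomp M N)
  interchange : ∀ {A B D A' B' D' A'' B'' D'' : C} {f : A ⟶ A'} {g : B ⟶ B'} {h : D ⟶ D'}
    {f' : A' ⟶ A''} {g' : B' ⟶ B''} {h' : D' ⟶ D''}
    {M : Hor B D} {M' : Hor B' D'} {M'' : Hor B'' D''}
    {N : Hor A B} {N' : Hor A' B'} {N'' : Hor A'' B''}
    (s : Sq g h M M') (s' : Sq g' h' M' M'') (t : Sq f g N N') (t' : Sq f' g' N' N''),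
    hcompSq (vcomp s s') (vcomp t t') = vcomp (hcompSq s t) (hcompSq s' t')
  /-- associator -/
  assoc : ∀ {A B D E : C} (M : Hor D E) (N : Hor B D) (P : Hor A B),
    Sq (𝟙 A) (𝟙 E) (hcomp (hcomp M N) P) (hcomp M (hcomp N P))
  assocInv : ∀ {A B D E : C} (M : Hor D E) (N : Hor B D) (P : Hor A B),
    Sq (𝟙 A) (𝟙 E) (hcomp M (hcomp N P)) (hcomp (hcomp M N) P)
  assoc_assocInv : ∀ {A B D E : C} (M : Hor D E) (N : Hor B D) (P : Hor A B),
    HEq (vcomp (assoc M N P) (assocInv M N P)) (vid (hcomp (hcomp M N) P))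
  assocInv_assoc : ∀ {A B D E : C} (M : Hor D E) (N : Hor B D) (P : Hor A B),
    HEq (vcomp (assocInv M N P) (assoc M N P)) (vid (hcomp M (hcomp N P)))
  assoc_naturality : ∀ {A B D E A' B' D' E' : C} {f : A ⟶ A'} {g : B ⟶ B'} {h : D ⟶ D'}
    {k : E ⟶ E'} {M : Hor D E} {M' : Hor D' E'} {N : Hor B D} {N' : Hor B' D'}
    {P : Hor A B} {P' : Hor A' B'} (s : Sq h k M M') (t : Sq g h N N') (r : Sq f g P P'),
    HEq (vcomp (hcompSq (hcompSq s t) r) (assoc M' N' P'))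
      (vcomp (assoc M N P) (hcompSq s (hcompSq t r)))
  /-- left unitor -/
  lunit : ∀ {A B : C} (M : Hor A B), Sq (𝟙 A) (𝟙 B) (hcomp (unit B) M) M
  lunitInv : ∀ {A B : C} (M : Hor A B), Sq (𝟙 A) (𝟙 B) M (hcomp (unit B) M)
  lunit_lunitInv : ∀ {A B : C} (M : Hor A B),
    HEq (vcomp (lunit M) (lunitInv M)) (vid (hcomp (unit B) M))
  lunitInv_lunit : ∀ {A B : C} (M : Hor A B), HEq (vcomp (lunitInv M) (lunit M)) (vid M)
  lunit_naturality : ∀ {A B A' B' : C} {f : A ⟶ A'} {g : B ⟶ B'} {M : Hor A B} {N : Hor A' B'}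
    (s : Sq f g M N), HEq (vcomp (hcompSq (unitSq g) s) (lunit N)) (vcomp (lunit M) s)
  /-- right unitor -/
  runit : ∀ {A B : C} (M : Hor A B), Sq (𝟙 A) (𝟙 B) (hcomp M (unit A)) M
  runitInv : ∀ {A B : C} (M : Hor A B), Sq (𝟙 A) (𝟙 B) M (hcomp M (unit A))
  runit_runitInv : ∀ {A B : C} (M : Hor A B),
    HEq (vcomp (runit M) (runitInv M)) (vid (hcomp M (unit A)))
  runitInv_runit : ∀ {A B : C} (M : Hor A B), HEq (vcomp (runitInv M) (runit M)) (vid M)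
  runit_naturality : ∀ {A B A' B' : C} {f : A ⟶ A'} {g : B ⟶ B'} {M : Hor A B} {N : Hor A' B'}
    (s : Sq f g M N), HEq (vcomp (hcompSq s (unitSq f)) (runit N)) (vcomp (runit M) s)
  triangle : ∀ {A B D : C} (M : Hor B D) (N : Hor A B),
    HEq (vcomp (assoc M (unit B) N) (hcompSq (vid M) (lunit N))) (hcompSq (runit M) (vid N))
  pentagon : ∀ {A B D E F : C} (M : Hor E F) (N : Hor D E) (P : Hor B D) (Q : Hor A B),
    HEq (vcomp (vcomp (hcompSq (assoc M N P) (vid Q)) (assoc M (hcomp N P) Q))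
        (hcompSq (vid M) (assoc N P Q)))
      (vcomp (assoc (hcomp M N) P Q) (assoc M N (hcomp P Q)))


end HybridDH

open HybridDH

/-! The composite of two directed systems is a pushout of hybrid systems, and the whole double
category structure is formal once this is known. Let `κ : B → H` be the final map of the first
system and `ι : B → H'` the initial map of the second. Since `κ` is invertible on every mode of `B`,
the map `β = ι ∘ κ⁻¹` is defined on the overlap. Since the image of `B` is a sink, the edges of `H`
outside it also start outside it, so their guards lie in modes that the gluing leaves alone and only
their resets are affected by `β`. Two semiconjugacies out of `H` and `H'` that agree on `B`
therefore glue uniquely (`Glue.desc`, `Glue.hom_ext`, `compSystem_isPushout`). Metrics play no part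
in the notion of morphism, so this is a pushout of metric hybrid systems too. Horizontal composites
of squares, associators and unitors are maps out of pushouts, and every law is checked by
restricting to the pieces that were glued.

That the composite is again directed needs geometry. Its final map is a composite of maps onto
sinks, and its initial map is an embedding because `β` is a diffeomorphism followed by an embedding.
For the chain condition, `β` need not respect distances, so a chain of `H` cannot simply be
transported. It is followed instead up to its first jump into the overlap; that jump is made with
error zero, and a chain of `H'` from the resulting point takes over (`reach_compInr`). The gap
condition survives because time already elapsed since the last jump without reset only helps
(`Reach.mono`). These cuts and splices are made on an inductive reachability relation `Reach`,
equivalent to the existence of a chain by `nonempty_chain_iff`. -/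

namespace HybridDH

/-! ### Embeddings and diffeomorphisms of smooth sets -/

namespace SmoothSet

/-- If the representatives are embeddings on `U` and `V`, their composite is one on `U ∩ f⁻¹(V)`,
which is open because `f` is continuous on the open set `U`. -/
theorem IsEmbedding.comp {A B C : SmoothSet.{u}} {f : A ⟶ B} {g : B ⟶ C}
    (hf : IsEmbedding f) (hg : IsEmbedding g) : IsEmbedding (f ≫ g) := by
  obtain ⟨f, rfl, U, hU, hAU, hfU, hfe, hfi⟩ := hf
  obtain ⟨g, rfl, V, hV, hBV, hgV, hge, hgi⟩ := hg
  have hW : IsOpen (U ∩ f.toFun ⁻¹' V) := hfU.continuousOn.isOpen_inter_preimage hU hV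
  refine ⟨f.comp g, rfl, U ∩ f.toFun ⁻¹' V, hW,
    fun x hx => ⟨hAU hx, hBV (f.maps x hx)⟩,
    hgV.comp (hfU.mono inter_subset_left) inter_subset_right, ?_, fun x hx => ?_⟩
  · have h1 : Topology.IsEmbedding
        (fun x : ↥(U ∩ f.toFun ⁻¹' V) => (⟨f.toFun x, x.2.2⟩ : V)) := by
      have h2 : Topology.IsEmbedding (fun x : ↥(U ∩ f.toFun ⁻¹' V) => (⟨x, x.2.1⟩ : U)) :=
        Topology.IsEmbedding.inclusion inter_subset_left
      have h3 := hfe.comp h2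
      -- The corestriction to `V` is an embedding because its composite with the inclusion of `V` is
      -- one.
      exact Topology.IsEmbedding.of_comp (h3.continuous.subtype_mk _) continuous_subtype_val h3
    exact hge.comp h1
  · have h1 : MDifferentiableAt (𝓡 A.M.dim) (𝓡 B.M.dim) f.toFun x :=
      (hfU.contMDiffAt (hU.mem_nhds hx.1)).mdifferentiableAt (by simp)
    have h2 : MDifferentiableAt (𝓡 B.M.dim) (𝓡 C.M.dim) g.toFun (f.toFun x) :=
      (hgV.contMDiffAt (hV.mem_nhds hx.2)).mdifferentiableAt (by simp)
    have h3 := mfderiv_comp x h2 h1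
    show Function.Injective (mfderiv (𝓡 A.M.dim) (𝓡 C.M.dim) (g.toFun ∘ f.toFun) x)
    rw [h3]
    exact (hgi _ hx.2).comp (hfi x hx.1)

/-- A representative `k` of the inverse satisfies `k ∘ f = id` near `A`, and `U` is shrunk so that
`f` maps it to where `k` is smooth. A continuous left inverse makes `f` a topological embedding on
`U`; by the chain rule the derivative of `k` is a left inverse of that of `f`. -/
theorem IsDiffeo.isEmbedding {A B : SmoothSet.{u}} {g : A ⟶ B} (hg : IsDiffeo g) :
    IsEmbedding g := by
  have : IsIso g := hg
  obtain ⟨f, hf⟩ := exists_rep g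
  obtain ⟨k, hk⟩ := exists_rep (inv g)
  have hfk : (f.comp k).germ = (Rep.id A).germ := by
    rw [Rep.germ_comp, hf, hk, IsIso.hom_inv_id, Rep.germ_id]
  rw [Rep.germ_eq_iff] at hfk
  obtain ⟨V, hV, hBV, hkV⟩ := mem_nhdsSet_iff_exists.1 k.smooth
  obtain ⟨U, hU, hAU, h⟩ := mem_nhdsSet_iff_exists.1
    (f.smooth.and (hfk.and (f.eventually_comp (hV.mem_nhdsSet.2 hBV))))
  have hfU : ContMDiffOn (𝓡 A.M.dim) (𝓡 B.M.dim) ∞ f.toFun U :=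
    fun x hx => (h hx).1.contMDiffWithinAt
  have hkc : ContinuousOn k.toFun V := fun y hy => (hkV hy).continuousAt.continuousWithinAt
  refine ⟨f, hf, U, hU, hAU, hfU, ?_, fun x hx => ?_⟩
  · have h1 : Continuous (fun x : U => (⟨f.toFun x, (h x.2).2.2⟩ : V)) :=
      hfU.continuousOn.domRestrict.subtype_mk _
    have h2 : Topology.IsEmbedding (V.domRestrict k.toFun ∘
        (fun x : U => (⟨f.toFun x, (h x.2).2.2⟩ : V))) := by
      have : V.domRestrict k.toFun ∘ (fun x : U => (⟨f.toFun x, (h x.2).2.2⟩ : V)) =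
          Subtype.val := funext fun x => (h x.2).2.1
      rw [this]
      exact .subtypeVal
    exact Topology.IsEmbedding.subtypeVal.comp
      (Topology.IsEmbedding.of_comp h1 hkc.domRestrict h2)
  · have h1 : MDifferentiableAt (𝓡 A.M.dim) (𝓡 B.M.dim) f.toFun x :=
      (h hx).1.mdifferentiableAt (by simp)
    have h2 : MDifferentiableAt (𝓡 B.M.dim) (𝓡 A.M.dim) k.toFun (f.toFun x) :=
      (hkV (h hx).2.2).mdifferentiableAt (by simp)
    have h3 := mfderiv_comp x h2 h1
    have h5 : (k.toFun ∘ f.toFun) =ᶠ[𝓝 x] id :=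
      Filter.eventually_of_mem (hU.mem_nhds hx) fun y hy => (h hy).2.1
    have h6 : HasMFDerivAt (𝓡 A.M.dim) (𝓡 A.M.dim) (k.toFun ∘ f.toFun) x
        (ContinuousLinearMap.id ℝ (TangentSpace (𝓡 A.M.dim) x)) :=
      (hasMFDerivAt_id x).congr_of_eventuallyEq h5
    have h7 := h3.symm.trans h6.mfderiv
    intro a b hab
    -- The value lies in the tangent space at `k (f x)`, which equals `x` only propositionally. Both
    -- tangent spaces unfold to the same Euclidean space, where the comparison is made.
    have h8 : ∀ c : TangentSpace (𝓡 A.M.dim) x,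
        (mfderiv (𝓡 B.M.dim) (𝓡 A.M.dim) k.toFun (f.toFun x)
          (mfderiv (𝓡 A.M.dim) (𝓡 B.M.dim) f.toFun x c) : EuclideanSpace ℝ (Fin A.M.dim)) = c :=
      fun c => congrArg (fun L : EuclideanSpace ℝ (Fin A.M.dim) →L[ℝ]
        EuclideanSpace ℝ (Fin A.M.dim) => L c) h7
    have h9 := congrArg (fun z => (mfderiv (𝓡 B.M.dim) (𝓡 A.M.dim) k.toFun (f.toFun x) z :
      EuclideanSpace ℝ (Fin A.M.dim))) hab
    exact (h8 a).symm.trans (h9.trans (h8 b))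

end SmoothSet

end HybridDH

/-! ### The composite as a pushout of graphs and of hybrid systems -/

namespace HybridDH

open HybridSystem

/-- The action of a semiconjugacy on a mode: the target mode, together with the smooth map. -/
def HybridSystem.Hom.onMode {H K : HybridSystem.{u}} (f : Hom H K) (v : H.graph.V) :
    Σ w : K.graph.V, (H.mode v).toSmoothSet ⟶ (K.mode w).toSmoothSet :=
  ⟨f.graph.onV v, f.map v⟩

/-- Semiconjugacies are determined by their actions on modes and on edges. -/
theorem HybridSystem.Hom.ext_onMode {H K : HybridSystem.{u}} {f g : Hom H K}
    (hm : ∀ v, f.onMode v = g.onMode v) (hE : ∀ e, f.graph.onE e = g.graph.onE e) : f = g := by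
  obtain ⟨⟨fV, fE, _, _⟩, fm, _, _⟩ := f
  obtain ⟨⟨gV, gE, _, _⟩, gm, _, _⟩ := g
  obtain rfl : fV = gV := funext fun v => congrArg Sigma.fst (hm v)
  obtain rfl : fE = gE := funext hE
  obtain rfl : fm = gm := funext fun v => eq_of_heq (Sigma.mk.inj (hm v)).2
  rfl

namespace Glue

variable {B H H' : HybridSystem.{u}}

/-- The graph morphism out of the composite that is induced by graph morphisms out of `H` and
`H'`. -/
def graphDesc {κ : Hom B H} (hκ : κ.IsFinal) (ι : Hom B H') {L : DirGraph.{u}}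
    (f : H.graph ⟶ L) (g : H'.graph ⟶ L) (hfg : κ.graph ≫ f = ι.graph ≫ g) :
    graph hκ ι ⟶ L where
  onV := Sum.elim g.onV (fun v => f.onV v.1)
  onE := Sum.elim g.onE (fun e => f.onE e.1)
  source_onE
    | Sum.inl e => g.source_onE e
    | Sum.inr e => f.source_onE e.1
  target_onE
    | Sum.inl e => g.target_onE e
    -- An edge outside `B` starts outside `B` but may end inside it. Only in that case is the
    -- agreement of `f` and `g` on `B` needed.
    | Sum.inr e => by
      refine (f.target_onE e.1).trans ?_
      show f.onV (H.graph.tgt e.1) = Sum.elim g.onV (fun v => f.onV v.1)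
        (ofMode hκ ι (H.graph.tgt e.1)).1
      by_cases h : ∃ b, κ.graph.onV b = H.graph.tgt e.1
      · obtain ⟨b, hb⟩ := h
        rw [← hb, ofMode_fst]
        exact congrFun (congrArg DirGraph.Hom.onV hfg) b
      · rw [ofMode_of_not hκ ι _ h]
        rfl

theorem inl_graphDesc {κ : Hom B H} (hκ : κ.IsFinal) (ι : Hom B H') {L : DirGraph.{u}}
    (f : H.graph ⟶ L) (g : H'.graph ⟶ L) (hfg : κ.graph ≫ f = ι.graph ≫ g) :
    (inl hκ ι).graph ≫ graphDesc hκ ι f g hfg = g := rfl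

theorem inr_graphDesc {κ : Hom B H} (hκ : κ.IsFinal) (ι : Hom B H') {L : DirGraph.{u}}
    (f : H.graph ⟶ L) (g : H'.graph ⟶ L) (hfg : κ.graph ≫ f = ι.graph ≫ g) :
    (inr hκ ι).graph ≫ graphDesc hκ ι f g hfg = f := by
  refine DirGraph.Hom.ext (funext fun v => ?_) (funext fun e => ?_)
  · show Sum.elim g.onV (fun v => f.onV v.1) (ofMode hκ ι v).1 = f.onV v
    by_cases h : ∃ b, κ.graph.onV b = v
    · obtain ⟨b, rfl⟩ := h
      rw [ofMode_fst]
      exact (congrFun (congrArg DirGraph.Hom.onV hfg) b).symm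
    · rw [ofMode_of_not hκ ι _ h]
      rfl
  · show (graphDesc hκ ι f g hfg).onCell (ofEdge ι e) = f.onE e
    by_cases h : ∃ b, κ.graph.onE b = Sum.inr e
    · obtain ⟨b, hb⟩ := h
      rw [ofEdge_onE hκ ι b e hb]
      refine (DirGraph.Hom.onCell_comp (inl hκ ι).graph (graphDesc hκ ι f g hfg) _).symm.trans ?_
      refine (congrFun (congrArg DirGraph.Hom.onE hfg) b).symm.trans ?_
      show f.onCell (κ.graph.onE b) = _
      rw [hb]
      rfl
    · rw [ofEdge_of_not ι e h]
      rfl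

theorem graph_comm {κ : Hom B H} (hκ : κ.IsFinal) (ι : Hom B H') :
    κ.graph ≫ (inr hκ ι).graph = ι.graph ≫ (inl hκ ι).graph := by
  refine DirGraph.Hom.ext (funext fun b => ofMode_fst hκ ι b) (funext fun b => ?_)
  obtain ⟨e, he⟩ := ((DirGraph.mono_iff _).1 hκ.mono).2.2 b
  show (inr hκ ι).graph.onCell (κ.graph.onE b) = (inl hκ ι).graph.onCell (ι.graph.onE b)
  rw [he]
  exact ofEdge_onE hκ ι b e he

/-- Graph morphisms may collapse edges, but the monic `κ` sends edges to edges, so vertices and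
edges can be glued separately. Each cell of the composite comes from `H'` or from a cell of `H`
outside `B`, which gives uniqueness. -/
theorem graph_isPushout {κ : Hom B H} (hκ : κ.IsFinal) (ι : Hom B H') :
    IsPushout (C := DirGraph.{u}) κ.graph ι.graph (inr hκ ι).graph (inl hκ ι).graph where
  w := graph_comm hκ ι
  isColimit' := ⟨Limits.PushoutCocone.IsColimit.mk _
    (fun s => graphDesc hκ ι s.inl s.inr s.condition)
    (fun s => inr_graphDesc hκ ι s.inl s.inr s.condition)
    (fun s => inl_graphDesc hκ ι s.inl s.inr s.condition)
    (fun s m h1 h2 => by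
      refine DirGraph.Hom.ext (funext ?_) (funext ?_)
      · rintro (v | ⟨v, hv⟩)
        · exact congrFun (congrArg DirGraph.Hom.onV h2) v
        · refine Eq.trans ?_ (congrFun (congrArg DirGraph.Hom.onV h1) v)
          exact congrArg m.onV (congrArg Sigma.fst (ofMode_of_not hκ ι v hv)).symm
      · rintro (e | ⟨e, he⟩)
        · exact congrFun (congrArg DirGraph.Hom.onE h2) e
        · refine Eq.trans ?_ (congrFun (congrArg DirGraph.Hom.onE h1) e)
          exact congrArg m.onCell (ofEdge_of_not ι e he).symm)⟩

/-- The modes of the composite are sent to `L` by `g` on `H'` and by `f` elsewhere. -/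
def modeDesc {κ : Hom B H} {L : HybridSystem.{u}} (f : Hom H L) (g : Hom H' L) :
    ∀ w : Vtx κ H', Σ l : L.graph.V, (mode κ H' w).toSmoothSet ⟶ (L.mode l).toSmoothSet
  | Sum.inl v => g.onMode v
  | Sum.inr v => f.onMode v.1

/-- On the overlap this is the computation `g ∘ β = g ∘ ι ∘ κ⁻¹ = f ∘ κ ∘ κ⁻¹ = f`; elsewhere the
map into the composite is the identity. -/
theorem ofMode_modeDesc {κ : Hom B H} (hκ : κ.IsFinal) (ι : Hom B H') {L : HybridSystem.{u}}
    (f : Hom H L) (g : Hom H' L) (hfg : Hom.comp κ f = Hom.comp ι g) (v : H.graph.V) :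
    (⟨(modeDesc f g (ofMode hκ ι v).1).1,
      (ofMode hκ ι v).2 ≫ (modeDesc f g (ofMode hκ ι v).1).2⟩ :
      Σ l : L.graph.V, (H.mode v).toSmoothSet ⟶ (L.mode l).toSmoothSet) = f.onMode v := by
  by_cases h : ∃ b, κ.graph.onV b = v
  · obtain ⟨b, rfl⟩ := h
    have : IsIso (κ.map b) := hκ.diffeo b
    rw [ofMode_onV]
    have h1 := congrArg (fun k : Hom B L => k.onMode b) hfg
    -- The inverse of `κ_b` is applied to the pair of target vertex and map, so no transport along
    -- an equality of vertices appears.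
    have h2 := congrArg (fun k : Σ l : L.graph.V, (B.mode b).toSmoothSet ⟶ (L.mode l).toSmoothSet =>
      (⟨k.1, inv (κ.map b) ≫ k.2⟩ : Σ l : L.graph.V,
        (H.mode (κ.graph.onV b)).toSmoothSet ⟶ (L.mode l).toSmoothSet)) h1
    refine Eq.trans ?_ (h2.symm.trans ?_)
    · exact congrArg (Sigma.mk (g.graph.onV (ι.graph.onV b))) (Category.assoc _ _ _)
    · exact congrArg (Sigma.mk (f.graph.onV (κ.graph.onV b)))
        (IsIso.inv_hom_id_assoc (κ.map b) (f.map (κ.graph.onV b)))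
  · rw [ofMode_of_not hκ ι _ h]
    exact congrArg (Sigma.mk (f.graph.onV v)) (Category.id_comp _)

/-- The smooth maps of modes out of the composite that are induced by `f` and `g`. -/
def mapDesc {κ : Hom B H} (hκ : κ.IsFinal) (ι : Hom B H') {L : HybridSystem.{u}}
    (f : Hom H L) (g : Hom H' L) (hfg : Hom.comp κ f = Hom.comp ι g) :
    ∀ w : Vtx κ H', (mode κ H' w).toSmoothSet ⟶
      (L.mode ((graphDesc hκ ι f.graph g.graph (congrArg Hom.graph hfg)).onV w)).toSmoothSet
  | Sum.inl v => g.map v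
  | Sum.inr v => f.map v.1

/-- The pointwise form of `ofMode_modeDesc`, needed for reset values, which were moved by `β` when
they lie in the overlap. -/
theorem mapDesc_stateInr {κ : Hom B H} (hκ : κ.IsFinal) (ι : Hom B H') {L : HybridSystem.{u}}
    (f : Hom H L) (g : Hom H' L) (hfg : Hom.comp κ f = Hom.comp ι g) (p : H.State) :
    (⟨(graphDesc hκ ι f.graph g.graph (congrArg Hom.graph hfg)).onV (stateInr hκ ι p).1,
      SmoothSet.app (mapDesc hκ ι f g hfg (stateInr hκ ι p).1) (stateInr hκ ι p).2⟩ : L.State) =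
      f.onState p := by
  have h1 : ∀ q : TotalSpace (mode κ H'),
      (⟨(graphDesc hκ ι f.graph g.graph (congrArg Hom.graph hfg)).onV q.1,
        SmoothSet.app (mapDesc hκ ι f g hfg q.1) q.2⟩ : L.State) =
      ⟨(modeDesc f g q.1).1, SmoothSet.app (modeDesc f g q.1).2 q.2⟩ := by
    rintro ⟨v | v, x⟩ <;> rfl
  refine (h1 _).trans ?_
  refine Eq.trans ?_ (congrArg (fun k : Σ l : L.graph.V,
    (H.mode p.1).toSmoothSet ⟶ (L.mode l).toSmoothSet =>
      (⟨k.1, SmoothSet.app k.2 p.2⟩ : L.State)) (ofMode_modeDesc hκ ι f g hfg p.1))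
  exact congrArg (Sigma.mk (modeDesc f g (ofMode hκ ι p.1).1).1)
    (SmoothSet.app_comp (ofMode hκ ι p.1).2 _ _).symm

/-- The semiconjugacy out of the composite that is induced by semiconjugacies out of `H` and
`H'`. -/
def desc {κ : Hom B H} (hκ : κ.IsFinal) (ι : Hom B H') {L : HybridSystem.{u}}
    (f : Hom H L) (g : Hom H' L) (hfg : Hom.comp κ f = Hom.comp ι g) : Hom (system hκ ι) L where
  graph := graphDesc hκ ι f.graph g.graph (congrArg Hom.graph hfg)
  map := mapDesc hκ ι f g hfg
  map_flow
    | Sum.inl v => g.map_flow v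
    | Sum.inr v => f.map_flow v.1
  map_jump
    | Sum.inl e, ⟨⟨Sum.inl v, x⟩, h⟩ => g.map_jump e ⟨⟨v, x⟩, h⟩
    | Sum.inl _, ⟨⟨Sum.inr _, _⟩, h⟩ => h.elim
    | Sum.inr _, ⟨⟨Sum.inl _, _⟩, h⟩ => h.elim
    | Sum.inr e, ⟨⟨Sum.inr v, x⟩, h⟩ => by
      have h1 := f.map_jump e.1 ⟨⟨v.1, x⟩, h⟩
      have h2 := mapDesc_stateInr hκ ι f g hfg (H.reset e.1 ⟨⟨v.1, x⟩, h⟩)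
      exact h2.symm ▸ h1

theorem inl_desc {κ : Hom B H} (hκ : κ.IsFinal) (ι : Hom B H') {L : HybridSystem.{u}}
    (f : Hom H L) (g : Hom H' L) (hfg : Hom.comp κ f = Hom.comp ι g) :
    Hom.comp (inl hκ ι) (desc hκ ι f g hfg) = g :=
  Hom.ext_onMode (fun v => congrArg (Sigma.mk (g.graph.onV v)) (Category.id_comp _))
    (fun _ => rfl)

theorem inr_desc {κ : Hom B H} (hκ : κ.IsFinal) (ι : Hom B H') {L : HybridSystem.{u}}
    (f : Hom H L) (g : Hom H' L) (hfg : Hom.comp κ f = Hom.comp ι g) :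
    Hom.comp (inr hκ ι) (desc hκ ι f g hfg) = f := by
  refine Hom.ext_onMode (fun v => Eq.trans ?_ (ofMode_modeDesc hκ ι f g hfg v))
    (congrFun (congrArg DirGraph.Hom.onE (inr_graphDesc hκ ι f.graph g.graph
      (congrArg Hom.graph hfg))))
  -- `mapDesc` and `modeDesc` agree by computation once the vertex is split into its two cases; this
  -- requires a variable in place of `ofMode hκ ι v`.
  have h1 : ∀ k : Σ w : Vtx κ H', (H.mode v).toSmoothSet ⟶ (mode κ H' w).toSmoothSet,
      (⟨_, k.2 ≫ mapDesc hκ ι f g hfg k.1⟩ :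
        Σ l : L.graph.V, (H.mode v).toSmoothSet ⟶ (L.mode l).toSmoothSet) =
      ⟨(modeDesc f g k.1).1, k.2 ≫ (modeDesc f g k.1).2⟩ := by
    rintro ⟨w | w, k⟩ <;> rfl
  exact h1 (ofMode hκ ι v)

/-- On modes this is `β ∘ κ = ι`, by cancelling `κ⁻¹ ∘ κ`. -/
theorem comm {κ : Hom B H} (hκ : κ.IsFinal) (ι : Hom B H') :
    Hom.comp κ (inr hκ ι) = Hom.comp ι (inl hκ ι) := by
  refine Hom.ext_onMode (fun b => ?_)
    (congrFun (congrArg DirGraph.Hom.onE (graph_comm hκ ι)))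
  have : IsIso (κ.map b) := hκ.diffeo b
  have h1 := congrArg (fun k : Σ w : Vtx κ H', (H.mode (κ.graph.onV b)).toSmoothSet ⟶
      (mode κ H' w).toSmoothSet =>
    (⟨k.1, κ.map b ≫ k.2⟩ : Σ w : Vtx κ H', (B.mode b).toSmoothSet ⟶ (mode κ H' w).toSmoothSet))
    (ofMode_onV hκ ι b)
  refine h1.trans (congrArg (Sigma.mk (Sum.inl (ι.graph.onV b))) ?_)
  exact (IsIso.hom_inv_id_assoc (κ.map b) (ι.map b)).trans (Category.comp_id (ι.map b)).symm

/-- Each mode of the composite is reached by an identity map, from `H'` or from a mode of `H`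
outside `B`, so the restrictions recover the semiconjugacy. -/
theorem hom_ext {κ : Hom B H} (hκ : κ.IsFinal) (ι : Hom B H') {L : HybridSystem.{u}}
    {m n : Hom (system hκ ι) L} (hl : Hom.comp (inl hκ ι) m = Hom.comp (inl hκ ι) n)
    (hr : Hom.comp (inr hκ ι) m = Hom.comp (inr hκ ι) n) : m = n := by
  refine Hom.ext_onMode ?_ ?_
  · rintro (v | ⟨v, hv⟩)
    · have h1 : ∀ k : Hom (system hκ ι) L, (Hom.comp (inl hκ ι) k).onMode v = k.onMode (Sum.inl v) :=
        fun k => congrArg (Sigma.mk (k.graph.onV (Sum.inl v))) (Category.id_comp _)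
      exact (h1 m).symm.trans ((congrArg (fun k : Hom H' L => k.onMode v) hl).trans (h1 n))
    · have h1 : ∀ k : Hom (system hκ ι) L,
          (Hom.comp (inr hκ ι) k).onMode v = k.onMode (Sum.inr ⟨v, hv⟩) := by
        intro k
        have h2 := congrArg (fun j : Σ w : Vtx κ H', (H.mode v).toSmoothSet ⟶
            (mode κ H' w).toSmoothSet =>
          (⟨k.graph.onV j.1, j.2 ≫ k.map j.1⟩ : Σ l : L.graph.V,
            (H.mode v).toSmoothSet ⟶ (L.mode l).toSmoothSet)) (ofMode_of_not hκ ι v hv)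
        exact h2.trans (congrArg (Sigma.mk (k.graph.onV (Sum.inr ⟨v, hv⟩))) (Category.id_comp _))
      exact (h1 m).symm.trans ((congrArg (fun k : Hom H L => k.onMode v) hr).trans (h1 n))
  · rintro (e | ⟨e, he⟩)
    · exact congrFun (congrArg (fun k : Hom H' L => k.graph.onE) hl) e
    · have h1 : ∀ k : Hom (system hκ ι) L,
          (Hom.comp (inr hκ ι) k).graph.onE e = k.graph.onE (Sum.inr ⟨e, he⟩) :=
        fun k => congrArg k.graph.onCell (ofEdge_of_not ι e he)
      exact (h1 m).symm.trans
        ((congrFun (congrArg (fun k : Hom H L => k.graph.onE) hr) e).trans (h1 n))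

end Glue

/-- Morphisms of metric hybrid systems ignore the metric, so the universal property of the glued
hybrid system carries over unchanged. -/
theorem compSystem_isPushout {A B C : MetricHybridSystem.{u}} (M : DirectedHybridSystem B C)
    (N : DirectedHybridSystem A B) : IsPushout N.fin M.init (compInr M N) (compInl M N) where
  w := Glue.comm N.directed.fin_final M.init
  isColimit' := ⟨Limits.PushoutCocone.IsColimit.mk _
    (fun s => Glue.desc N.directed.fin_final M.init s.inl s.inr s.condition)
    (fun s => Glue.inr_desc N.directed.fin_final M.init s.inl s.inr s.condition)
    (fun s => Glue.inl_desc N.directed.fin_final M.init s.inl s.inr s.condition)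
    (fun s _ h1 h2 => Glue.hom_ext N.directed.fin_final M.init
      (h2.trans (Glue.inl_desc N.directed.fin_final M.init s.inl s.inr s.condition).symm)
      (h1.trans (Glue.inr_desc N.directed.fin_final M.init s.inl s.inr s.condition).symm))⟩

end HybridDH

/-! ### Chains as an inductive reachability relation -/

namespace HybridDH

open HybridSystem

/-- `φ` is a piece of a chain over the time interval `[a, b]` in the mode `m`. -/
structure Mode.IsPiece (m : Mode.{u}) (a b : ℝ) (φ : ℝ → m.M.pt) : Prop where
  le : a ≤ b
  smooth : ∀ᶠ t in 𝓝ˢ (Icc a b), ContMDiffAt 𝓘(ℝ, ℝ) (𝓡 m.M.dim) ∞ φ t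
  active : ∀ t ∈ Icc a b, φ t ∈ m.carrier
  flow : ∀ t ∈ Ico a b, φ t ∈ m.F
  integral : IsMIntegralCurveOn (I := 𝓡 m.M.dim) φ m.X (Ico a b)

namespace Mode.IsPiece

variable {m : Mode.{u}} {a b : ℝ} {φ : ℝ → m.M.pt}

theorem start_mem (h : m.IsPiece a b φ) : φ a ∈ m.carrier := h.active a ⟨le_rfl, h.le⟩

theorem finish_mem (h : m.IsPiece a b φ) : φ b ∈ m.carrier := h.active b ⟨h.le, le_rfl⟩

/-- Degenerate pieces of this kind fill the irrelevant tail of a `PieceSeq`. -/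
theorem right (h : m.IsPiece a b φ) : m.IsPiece b b φ where
  le := le_rfl
  smooth := h.smooth.filter_mono (nhdsSet_mono (Icc_subset_Icc_left h.le))
  active t ht := h.active t (Icc_subset_Icc_left h.le ht)
  flow t ht := h.flow t (Ico_subset_Ico_left h.le ht)
  integral := h.integral.mono (Ico_subset_Ico_left h.le)

/-- Over an interval of length zero the flow conditions are vacuous, so `x` may be any active point,
in the flow set or not. -/
theorem const (x : m.carrier) : m.IsPiece a a (fun _ => x) where
  le := le_rfl
  smooth := Eventually.of_forall fun _ => contMDiffAt_const
  active _ _ := x.2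
  flow t ht := absurd ht (by simp)
  integral t ht := absurd ht (by simp)

/-- Pieces may be translated in time. -/
theorem shift (h : m.IsPiece a b φ) (c : ℝ) :
    m.IsPiece (a - c) (b - c) (φ ∘ (· + c)) where
  le := sub_le_sub_right h.le c
  smooth := by
    rw [eventually_nhdsSet_iff_forall]
    intro t ht
    have h1 := eventually_nhdsSet_iff_forall.1 h.smooth (t + c)
      ⟨by linarith [ht.1], by linarith [ht.2]⟩
    have h2 : Tendsto (· + c) (𝓝 t) (𝓝 (t + c)) := (continuous_add_const c).tendsto t
    filter_upwards [h2.eventually h1] with x hx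
    have h3 : ContMDiffAt 𝓘(ℝ, ℝ) 𝓘(ℝ, ℝ) ∞ (fun y : ℝ => y + c) x :=
      (contDiff_id.add contDiff_const).contMDiff.contMDiffAt
    exact hx.comp x h3
  active t ht := h.active _ ⟨by linarith [ht.1], by linarith [ht.2]⟩
  flow t ht := h.flow _ ⟨by linarith [ht.1], by linarith [ht.2]⟩
  integral := by
    have h1 := h.integral.comp_add c
    refine h1.mono fun t ht => ?_
    exact ⟨by linarith [ht.1], by linarith [ht.2]⟩

end Mode.IsPiece

/-- The flow of `H` leads from `p` to `p'` in time `d`. -/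
def HybridSystem.FlowsTo (H : HybridSystem.{u}) (d : ℝ) (p p' : H.State) : Prop :=
  ∃ (v : H.graph.V) (a b : ℝ) (φ : ℝ → (H.mode v).M.pt) (h : (H.mode v).IsPiece a b φ),
    b - a = d ∧ p = ⟨v, φ a, h.start_mem⟩ ∧ p' = ⟨v, φ b, h.finish_mem⟩

theorem HybridSystem.FlowsTo.nonneg {H : HybridSystem.{u}} {d : ℝ} {p p' : H.State}
    (h : H.FlowsTo d p p') : 0 ≤ d := by
  obtain ⟨v, a, b, φ, h, rfl, -⟩ := h
  exact sub_nonneg.2 h.le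

theorem HybridSystem.FlowsTo.fst_eq {H : HybridSystem.{u}} {d : ℝ} {p p' : H.State}
    (h : H.FlowsTo d p p') : p.1 = p'.1 := by
  obtain ⟨v, a, b, φ, h, -, rfl, rfl⟩ := h
  rfl

theorem HybridSystem.Jump.source_eq {H : HybridSystem.{u}} {c : H.graph.V ⊕ H.graph.E}
    {p q : H.State} (h : H.Jump c p q) : H.graph.source c = p.1 := by
  cases c with
  | inl v => exact h.1.symm
  | inr e => exact (H.guard_src e p h.1).symm

theorem HybridSystem.Jump.target_eq {H : HybridSystem.{u}} {c : H.graph.V ⊕ H.graph.E}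
    {p q : H.State} (h : H.Jump c p q) : H.graph.target c = q.1 := by
  cases c with
  | inl v => obtain ⟨rfl, -, rfl⟩ := h; rfl
  | inr e => obtain ⟨h, rfl⟩ := h; exact (H.reset_tgt e _).symm

/-- `y` can be reached by an `(ε, T)`-chain that starts a time `s` after the last jump without
reset. -/
inductive Reach (H : MetricHybridSystem.{u}) (ε T : ℝ) (y : H.State) : ℝ → H.State → Prop
  | last {s d : ℝ} {p : H.State} : H.FlowsTo d p y → Reach H ε T y s p
  -- The clock runs on through resets and returns to zero at jumps without reset. Testing it against
  -- `T` at each such jump bounds consecutive gaps, hence all of them.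
  | step {s d : ℝ} {p p' q p'' : H.State} {c : H.graph.V ⊕ H.graph.E} :
      H.FlowsTo d p p' → H.Jump c p' q → H.graph.target c = p''.1 →
      H.metric.edist p'' q ≤ ENNReal.ofReal ε → (c.isLeft → T ≤ s + d) →
      Reach H ε T y (if c.isLeft then 0 else s + d) p'' → Reach H ε T y s p

variable {H : MetricHybridSystem.{u}} {ε T : ℝ}

/-- A larger clock only relaxes the gap condition. A chain built to start at clock zero can thus be
appended to one whose clock is already running. -/
theorem Reach.mono {y p : H.State} {s s' : ℝ} (h : Reach H ε T y s p) (hs : s ≤ s') :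
    Reach H ε T y s' p := by
  induction h generalizing s' with
  | last h => exact .last h
  | @step s d p p' q p'' c hf hj ht he hT _ ih =>
    refine .step hf hj ht he (fun hc => (hT hc).trans (by linarith)) (ih ?_)
    split_ifs <;> linarith

theorem Chain.reach {x y : H.State} (C : Chain H ε T x y) : Reach H ε T y 0 x := by
  have hp : ∀ j, (H.mode (C.ν j)).IsPiece (C.τ j.castSucc) (C.τ j.succ) (C.φ j) := fun j =>
    ⟨C.τ_mono j.castSucc_lt_succ.le, C.smooth j, C.active j, C.flow j, C.integral j⟩
  -- The induction runs backwards over the pieces with the clock `s` left free. The hypothesis keeps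
  -- exactly those gap bounds that concern jumps from piece `j` on.
  have key : ∀ (j : Fin (C.n + 1)) (s : ℝ),
      (∀ i : Fin C.n, j ≤ i.castSucc → (C.jump i).isLeft →
        T ≤ s + (C.τ i.castSucc.succ - C.τ j.castSucc)) →
      Reach H ε T y s ⟨C.ν j, C.φ j (C.τ j.castSucc), (hp j).start_mem⟩ := by
    intro j
    induction j using Fin.reverseInduction with
    | last =>
      intro s _
      exact .last ⟨_, _, _, _, hp (Fin.last C.n), rfl, rfl, C.end_eq⟩
    | cast i ih =>
      intro s hs
      obtain ⟨q, hq, hd⟩ := C.jump_le i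
      refine .step (d := C.τ i.castSucc.succ - C.τ i.castSucc.castSucc)
        ⟨_, _, _, _, hp i.castSucc, rfl, rfl, rfl⟩ hq (C.target_jump i) hd
        (hs i le_rfl) (ih _ fun k hk hl => ?_)
      have hik : i < k := Fin.succ_le_castSucc_iff.1 hk
      -- The next piece begins when the current one ends.
      have e : C.τ i.succ.castSucc = C.τ i.castSucc.succ := rfl
      split_ifs with hi
      · rw [zero_add]
        exact C.gap i k hik hi hl
      · have := hs k (Fin.castSucc_le_castSucc_iff.2 hik.le) hl
        rw [e]
        linarith
  have h := key 0 0 fun i _ hl => by rw [zero_add]; exact C.gap_start i hl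
  rw [C.start_eq]
  exact h

/-- A chain in which the pieces are indexed by all natural numbers (those after the `n`th are
irrelevant), which starts at time `t₀`, a time `s` after the last jump without reset. -/
structure PieceSeq (H : MetricHybridSystem.{u}) (ε T s t₀ : ℝ) (p y : H.State) where
  n : ℕ
  τ : ℕ → ℝ
  Q : ℕ → Σ v, ℝ → (H.mode v).M.pt
  c : ℕ → H.graph.V ⊕ H.graph.E
  τ_zero : τ 0 = t₀
  piece : ∀ j, (H.mode (Q j).1).IsPiece (τ j) (τ (j + 1)) (Q j).2
  start : p = ⟨(Q 0).1, (Q 0).2 (τ 0), (piece 0).start_mem⟩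
  finish : y = ⟨(Q n).1, (Q n).2 (τ (n + 1)), (piece n).finish_mem⟩
  target : ∀ j < n, H.graph.target (c j) = (Q (j + 1)).1
  jump : ∀ j < n, ∃ q, H.Jump (c j) ⟨(Q j).1, (Q j).2 (τ (j + 1)), (piece j).finish_mem⟩ q ∧
    H.metric.edist ⟨(Q (j + 1)).1, (Q (j + 1)).2 (τ (j + 1)), (piece (j + 1)).start_mem⟩ q ≤
      ENNReal.ofReal ε
  gap_start : ∀ j < n, (c j).isLeft → T ≤ s + (τ (j + 1) - t₀)
  gap : ∀ i j, i < j → j < n → (c i).isLeft → (c j).isLeft → T ≤ τ (j + 1) - τ (i + 1)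

/-- The first piece is translated to start at `t₀` and prepended to a sequence built to start when
that piece ends; this is why `t₀` is arbitrary. Indexing by natural numbers turns prepending into a
case split. -/
theorem Reach.nonempty_pieceSeq {y p : H.State} {s : ℝ} (h : Reach H ε T y s p) (hs : 0 ≤ s)
    (t₀ : ℝ) : Nonempty (PieceSeq H ε T s t₀ p y) := by
  induction h generalizing t₀ with
  | @last s d p h =>
    obtain ⟨v, a, b, φ, h, rfl, rfl, rfl⟩ := h
    have h1 := h.shift (a - t₀)
    have e1 : a - (a - t₀) = t₀ := by ring
    have e2 : t₀ + (a - t₀) = a := by ring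
    have e3 : b - (a - t₀) + (a - t₀) = b := by ring
    rw [e1] at h1
    -- All times after the zeroth are the end time, so later pieces are degenerate. The jump labels
    -- are placeholders, as no index lies below zero.
    refine ⟨⟨0, fun k => k.casesOn t₀ fun _ => b - (a - t₀),
      fun _ => ⟨v, φ ∘ (· + (a - t₀))⟩, fun _ => Sum.inl v, rfl, ?_, ?_, ?_, ?_, ?_, ?_, ?_⟩⟩
    · rintro (_ | j)
      · exact h1
      · exact h1.right
    · refine congrArg (Sigma.mk v) (Subtype.ext ?_)
      show φ a = φ (t₀ + (a - t₀))
      rw [e2]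
    · refine congrArg (Sigma.mk v) (Subtype.ext ?_)
      show φ b = φ (b - (a - t₀) + (a - t₀))
      rw [e3]
    all_goals intros; omega
  | @step s d p p' q p'' c hf hj ht he hT _ ih =>
    obtain ⟨v, a, b, φ, h, rfl, rfl, rfl⟩ := hf
    have hab := h.le
    obtain ⟨S⟩ := ih (by split_ifs <;> linarith) (t₀ + (b - a))
    have h1 := h.shift (a - t₀)
    have e1 : a - (a - t₀) = t₀ := by ring
    have e2 : t₀ + (a - t₀) = a := by ring
    have e3 : S.τ 0 + (a - t₀) = b := by rw [S.τ_zero]; ring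
    have e4 : b - (a - t₀) = S.τ 0 := by rw [S.τ_zero]; ring
    rw [e1, e4] at h1
    refine ⟨⟨S.n + 1, fun k => k.casesOn t₀ S.τ,
      fun k => k.casesOn ⟨v, φ ∘ (· + (a - t₀))⟩ S.Q, fun k => k.casesOn c S.c, rfl, ?_, ?_,
      S.finish, ?_, ?_, ?_, ?_⟩⟩
    · rintro (_ | j)
      · exact h1
      · exact S.piece j
    · refine congrArg (Sigma.mk v) (Subtype.ext ?_)
      show φ a = φ (t₀ + (a - t₀))
      rw [e2]
    · rintro (_ | j) hn
      · exact ht.trans (congrArg Sigma.fst S.start)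
      · exact S.target j (by omega)
    · rintro (_ | j) hn
      · refine ⟨q, ?_, ?_⟩
        · have : (⟨v, φ b, h.finish_mem⟩ : H.State) =
              ⟨v, (φ ∘ (· + (a - t₀))) (S.τ 0), h1.finish_mem⟩ := by
            refine congrArg (Sigma.mk v) (Subtype.ext ?_)
            show φ b = φ (S.τ 0 + (a - t₀))
            rw [e3]
          exact this ▸ hj
        · have := S.start
          exact this ▸ he
      · exact S.jump j (by omega)
    · rintro (_ | j) hn hc
      · have := hT hc
        show T ≤ s + (S.τ 0 - t₀)
        rw [S.τ_zero]
        linarith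
      · have h2 := S.gap_start j (by omega) hc
        show T ≤ s + (S.τ (j + 1) - t₀)
        -- If the first jump has no reset, the tail is measured from clock zero; since `s` and `b -
        -- a` are nonnegative, the required bound is weaker.
        split_ifs at h2 <;> linarith
    · rintro (_ | i) (_ | j) hij hn hi hj'
      · omega
      -- The first jump set the clock to zero, so the tail's bound from its start is precisely the
      -- gap to that jump.
      · have h2 := S.gap_start j (by omega) hj'
        have h3 : c.isLeft := hi
        simp only [h3, if_true, zero_add] at h2
        show T ≤ S.τ (j + 1) - S.τ 0
        exact h2.trans_eq (congrArg _ S.τ_zero.symm)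
      · omega
      · exact S.gap i j (by omega) (by omega) hi hj'

theorem PieceSeq.nonempty_chain {y p : H.State} (S : PieceSeq H ε T 0 0 p y) :
    Nonempty (Chain H ε T p y) := ⟨{
  n := S.n
  τ := fun j => S.τ j
  τ_zero := S.τ_zero
  τ_mono := (monotone_nat_of_le_succ fun j => (S.piece j).le).comp Fin.val_strictMono.monotone
  ν := fun j => (S.Q j).1
  φ := fun j => (S.Q j).2
  smooth := fun j => (S.piece j).smooth
  active := fun j => (S.piece j).active
  flow := fun j => (S.piece j).flow
  integral := fun j => (S.piece j).integral
  jump := fun j => S.c j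
  source_jump := fun j => by
    obtain ⟨q, hq, -⟩ := S.jump j j.2
    exact hq.source_eq
  target_jump := fun j => S.target j j.2
  jump_le := fun j => S.jump j j.2
  gap_start := fun j hj => by
    have := S.gap_start j j.2 hj
    rw [zero_add] at this
    exact this.trans_eq (congrArg _ S.τ_zero.symm)
  gap := fun i j hij => S.gap i j hij j.2
  start_eq := S.start
  end_eq := S.finish }⟩

theorem nonempty_chain_iff {x y : H.State} : Nonempty (Chain H ε T x y) ↔ Reach H ε T y 0 x :=
  ⟨fun ⟨C⟩ => C.reach, fun h => (h.nonempty_pieceSeq le_rfl 0).elim PieceSeq.nonempty_chain⟩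

end HybridDH

/-! ### Units and composites are directed -/

namespace HybridDH

open HybridSystem

theorem Reach.refl {H : MetricHybridSystem.{u}} {ε T : ℝ} (s : ℝ) (p : H.State) :
    Reach H ε T p s p :=
  .last ⟨p.1, 0, 0, fun _ => p.2, .const p.2, sub_self 0, rfl, rfl⟩

section Composite

variable {A B C : MetricHybridSystem.{u}} {ε T : ℝ}

/-- The second system sits in the composite with its modes, jumps and metric unchanged, so its
chains are chains there. -/
theorem reach_compInl (M : DirectedHybridSystem B C) (N : DirectedHybridSystem A B)
    {y p : M.sys.State} {s : ℝ} (h : Reach M.sys ε T y s p) :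
    Reach (compSystem M N) ε T (Hom.onState (compInl M N) y) s (Hom.onState (compInl M N) p) := by
  have hflow : ∀ {d : ℝ} {p p' : M.sys.State}, M.sys.FlowsTo d p p' →
      (compSystem M N).FlowsTo d (Hom.onState (compInl M N) p)
        (Hom.onState (compInl M N) p') := by
    rintro d p p' ⟨v, a, b, φ, h, rfl, rfl, rfl⟩
    exact ⟨Sum.inl v, a, b, φ, h, rfl, rfl, rfl⟩
  induction h with
  | last h => exact .last (hflow h)
  | @step s d p p' q p'' c hf hj ht he hT _ ih =>
    -- A semiconjugacy may in general turn an edge into a vertex, which would affect the clock; the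
    -- inclusion does not.
    have hc : ((compInl M N).graph.onCell c).isLeft = c.isLeft := by cases c <;> rfl
    refine .step (hflow hf) (Hom.jump (compInl M N) hj) ?_ ?_ ?_ (by rw [hc]; exact ih)
    · exact (DirGraph.Hom.target_onCell _ c).trans (congrArg _ ht)
    · exact he
    · rw [hc]
      exact hT

theorem onState_compInr_of_not (M : DirectedHybridSystem B C) (N : DirectedHybridSystem A B)
    (p : N.sys.State) (h : ¬ ∃ b, N.fin.graph.onV b = p.1) :
    Hom.onState (compInr M N) p = ⟨Sum.inr ⟨p.1, h⟩, p.2⟩ :=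
  congrArg (fun w : Σ w : Glue.Vtx N.fin M.sys.toHybridSystem,
      (N.sys.mode p.1).toSmoothSet ⟶ (Glue.mode N.fin M.sys.toHybridSystem w).toSmoothSet =>
    (⟨w.1, SmoothSet.app w.2 p.2⟩ : TotalSpace (Glue.mode N.fin M.sys.toHybridSystem)))
    (Glue.ofMode_of_not N.directed.fin_final M.init p.1 h)

theorem onState_compInr_fin (M : DirectedHybridSystem B C) (N : DirectedHybridSystem A B)
    (q : B.State) : Hom.onState (compInr M N) (Hom.onState N.fin q) =
      Hom.onState (compInl M N) (Hom.onState M.init q) :=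
  Glue.stateInr_onState N.directed.fin_final M.init q

/-- The restriction to points outside the overlap is essential: `β` is not assumed to preserve
distances. -/
theorem edist_compInr (M : DirectedHybridSystem B C) (N : DirectedHybridSystem A B)
    (p q : N.sys.State) (hp : ¬ ∃ b, N.fin.graph.onV b = p.1)
    (hq : ¬ ∃ b, N.fin.graph.onV b = q.1) :
    (compSystem M N).metric.edist (Hom.onState (compInr M N) p) (Hom.onState (compInr M N) q) =
      N.sys.metric.edist p q := by
  rw [onState_compInr_of_not M N p hp, onState_compInr_of_not M N q hq]
  rfl

/-- Follow the first system up to the first jump into the overlap, make that jump exactly, and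
continue in the second system. -/
theorem reach_compInr (M : DirectedHybridSystem B C) (N : DirectedHybridSystem A B)
    (hM : ∀ q : M.sys.State, ∃ y : C.State, Reach M.sys ε T (Hom.onState M.fin y) 0 q)
    {y : B.State} {p : N.sys.State} {s : ℝ} (h : Reach N.sys ε T (Hom.onState N.fin y) s p)
    (hs : 0 ≤ s) (hp : ¬ ∃ b, N.fin.graph.onV b = p.1) :
    ∃ z : C.State, Reach (compSystem M N) ε T
      (Hom.onState (compInl M N) (Hom.onState M.fin z)) s (Hom.onState (compInr M N) p) := by
  have hflow : ∀ {d : ℝ} {p p' : N.sys.State}, N.sys.FlowsTo d p p' →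
      (¬ ∃ b, N.fin.graph.onV b = p.1) →
      (compSystem M N).FlowsTo d (Hom.onState (compInr M N) p)
        (Hom.onState (compInr M N) p') := by
    rintro d p p' ⟨v, a, b, φ, h, rfl, rfl, rfl⟩ hp
    exact ⟨Sum.inr ⟨v, hp⟩, a, b, φ, h, rfl,
      onState_compInr_of_not M N ⟨v, φ a, h.start_mem⟩ hp,
      onState_compInr_of_not M N ⟨v, φ b, h.finish_mem⟩ hp⟩
  induction h with
  -- Flowing does not change the mode, so a chain from outside `B` into `B` must jump.
  | last h => exact absurd ⟨y.1, h.fst_eq.symm⟩ hp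
  | @step s d p p' q p'' c hf hj ht he hT _ ih =>
    have hp' : ¬ ∃ b, N.fin.graph.onV b = p'.1 := hf.fst_eq ▸ hp
    have hd := hf.nonneg
    have hj' := Hom.jump (compInr M N) hj
    have hc : ((compInr M N).graph.onCell c).isLeft = c.isLeft := by
      cases c with
      | inl v => rfl
      | inr e =>
        -- An edge coming from `B` would start in `B`. Hence `e` stays an edge in the composite and
        -- is not collapsed by `ι`.
        have he' : ¬ ∃ b, N.fin.graph.onE b = Sum.inr e := by
          rintro ⟨b, hb⟩
          refine hp' ⟨B.graph.src b, ?_⟩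
          rw [← N.fin.graph.source_onE, hb]
          exact hj.source_eq
        show (Glue.ofEdge M.init e).isLeft = _
        rw [Glue.ofEdge_of_not M.init e he']
        rfl
    have hqp : q.1 = p''.1 := hj.target_eq.symm.trans ht
    by_cases hp'' : ∃ b, N.fin.graph.onV b = p''.1
    -- The approximate landing point `p''` is abandoned for the exact one `q`, which lies in the
    -- same mode and so comes from a point `r` of `B`. The second system continues from the image of
    -- `r`.
    · obtain ⟨r, hr⟩ := Glue.exists_onState N.directed.fin_final q (hqp ▸ hp'')
      obtain ⟨z, hz⟩ := hM (Hom.onState M.init r)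
      have hz' := reach_compInl M N hz
      rw [← onState_compInr_fin, hr] at hz'
      refine ⟨z, .step (hflow hf hp) hj' hj'.target_eq ?_ (by rw [hc]; exact hT)
        (hz'.mono ?_)⟩
      · rw [(compSystem M N).metric.edist_self]
        exact zero_le
      -- The appended chain assumes clock zero, while the clock here is only known to be
      -- nonnegative.
      · split_ifs <;> linarith
    · obtain ⟨z, hz⟩ := ih (by split_ifs <;> linarith) hp''
      refine ⟨z, .step (hflow hf hp) hj'
        ((DirGraph.Hom.target_onCell _ c).trans (congrArg _ ht)) ?_ (by rw [hc]; exact hT)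
        (by rw [hc]; exact hz)⟩
      rw [edist_compInr M N p'' q hp'' (hqp ▸ hp'')]
      exact he

end Composite

theorem HybridSystem.Hom.isFinal_id (H : HybridSystem.{u}) : (Hom.id H).IsFinal where
  mono := inferInstanceAs (Mono (𝟙 H.graph))
  embedding v := SmoothSet.IsDiffeo.isEmbedding (inferInstanceAs (IsIso (𝟙 (H.mode v).toSmoothSet)))
  diffeo v := inferInstanceAs (IsIso (𝟙 (H.mode v).toSmoothSet))
  flow _ _ hx := hx
  guard _ _ h _ hp := Sum.inr_injective h ▸ hp
  sink e _ := ⟨e, rfl⟩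

/-- Every point already lies in the final system, so a chain of one degenerate piece suffices. -/
theorem isDirected_unitCospan (A : MetricHybridSystem.{u}) : (unitCospan A).IsDirected where
  init_embedding := (Hom.isFinal_id A.toHybridSystem).toIsEmbedding
  fin_final := Hom.isFinal_id A.toHybridSystem
  chain _ _ _ _ x := ⟨x, nonempty_chain_iff.2 (.refl 0 x)⟩

theorem HybridSystem.Hom.IsEmbedding.comp {H K L : HybridSystem.{u}} {f : Hom H K} {g : Hom K L}
    (hf : f.IsEmbedding) (hg : g.IsEmbedding) : (Hom.comp f g).IsEmbedding where
  mono := by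
    have := hf.mono
    have := hg.mono
    exact mono_comp f.graph g.graph
  embedding v := (hf.embedding v).comp (hg.embedding _)

theorem HybridSystem.Hom.IsFinal.comp {H K L : HybridSystem.{u}} {f : Hom H K} {g : Hom K L}
    (hf : f.IsFinal) (hg : g.IsFinal) : (Hom.comp f g).IsFinal where
  toIsEmbedding := hf.toIsEmbedding.comp hg.toIsEmbedding
  diffeo v := by
    have : IsIso (f.map v) := hf.diffeo v
    have : IsIso (g.map (f.graph.onV v)) := hg.diffeo _
    exact inferInstanceAs (IsIso (f.map v ≫ g.map (f.graph.onV v)))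
  flow v x hx := hf.flow v x (hg.flow _ _ (by rw [← SmoothSet.app_comp]; exact hx))
  guard e e' h p hp := by
    obtain ⟨k, hk⟩ := ((DirGraph.mono_iff _).1 hf.mono).2.2 e
    have h1 : g.graph.onE k = Sum.inr e' := by
      have h2 : g.graph.onCell (f.graph.onE e) = Sum.inr e' := h
      rwa [hk] at h2
    refine hf.guard e k hk p (hg.guard k e' h1 _ ?_)
    have h3 : (Hom.comp f g).onState p = g.onState (f.onState p) :=
      congrArg (Sigma.mk (g.graph.onV (f.graph.onV p.1))) (SmoothSet.app_comp _ _ _)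
    exact h3 ▸ hp
  sink e h := by
    obtain ⟨v, hv⟩ := h
    obtain ⟨k, hk⟩ := hg.sink e ⟨f.graph.onV v, hv⟩
    -- The edge has been lifted to `K`; injectivity of `g` on vertices shows that the lift starts in
    -- the image of `f`, so the sink condition of `f` lifts it once more.
    have h1 : K.graph.src k = f.graph.onV v := by
      refine ((DirGraph.mono_iff _).1 hg.mono).1 ?_
      rw [← g.graph.source_onE, hk]
      exact hv.symm
    obtain ⟨j, hj⟩ := hf.sink k ⟨v, h1.symm⟩
    refine ⟨j, ?_⟩
    show g.graph.onCell (f.graph.onE j) = _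
    rw [hj]
    exact hk

namespace Glue

variable {B H H' : HybridSystem.{u}}

/-- By construction the edges of the composite that come from `H` start at vertices outside `H'`, so
`H'` is a sink. -/
theorem inl_isFinal {κ : Hom B H} (hκ : κ.IsFinal) (ι : Hom B H') : (inl hκ ι).IsFinal where
  mono := (DirGraph.mono_iff _).2 ⟨Sum.inl_injective,
    fun _ _ h => Sum.inl_injective (Sum.inr_injective h), fun e => ⟨Sum.inl e, rfl⟩⟩
  embedding v := SmoothSet.IsDiffeo.isEmbedding
    (inferInstanceAs (IsIso (𝟙 (H'.mode v).toSmoothSet)))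
  diffeo v := inferInstanceAs (IsIso (𝟙 (H'.mode v).toSmoothSet))
  flow _ _ hx := hx
  guard e e' h p hp := by
    obtain rfl := Sum.inr_injective h
    exact hp
  sink
    | Sum.inl e, _ => ⟨e, rfl⟩
    | Sum.inr _, ⟨_, hv⟩ => absurd hv Sum.inl_ne_inr

/-- On the overlap `β` is a diffeomorphism followed by an embedding. As `ι` is monic, overlapping
edges stay edges and remain distinct, and they cannot meet the edges outside `B`. -/
theorem inr_isEmbedding {κ : Hom B H} (hκ : κ.IsFinal) {ι : Hom B H'} (hι : ι.IsEmbedding) :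
    (inr hκ ι).IsEmbedding where
  mono := by
    obtain ⟨hV, hE, hI⟩ := (DirGraph.mono_iff _).1 hι.mono
    have hofE : ∀ b e, κ.graph.onE b = Sum.inr e → ∃ e', ι.graph.onE b = Sum.inr e' ∧
        ofEdge (κ := κ) ι e = Sum.inr (Sum.inl e') := by
      intro b e hb
      obtain ⟨e', he'⟩ := hI b
      refine ⟨e', he', ?_⟩
      rw [ofEdge_onE hκ ι b e hb, he']
      rfl
    refine (DirGraph.mono_iff _).2 ⟨fun v w h => ?_, fun e k h => ?_, fun e => ?_⟩
    · replace h : (ofMode hκ ι v).1 = (ofMode hκ ι w).1 := h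
      by_cases hv : ∃ b, κ.graph.onV b = v <;> by_cases hw : ∃ b, κ.graph.onV b = w
      · obtain ⟨b, rfl⟩ := hv
        obtain ⟨c, rfl⟩ := hw
        rw [ofMode_fst, ofMode_fst] at h
        rw [hV (Sum.inl_injective h)]
      · obtain ⟨b, rfl⟩ := hv
        rw [ofMode_fst, ofMode_of_not hκ ι w hw] at h
        exact absurd h Sum.inl_ne_inr
      · obtain ⟨c, rfl⟩ := hw
        rw [ofMode_fst, ofMode_of_not hκ ι v hv] at h
        exact absurd h Sum.inr_ne_inl
      · rw [ofMode_of_not hκ ι v hv, ofMode_of_not hκ ι w hw] at h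
        exact congrArg Subtype.val (Sum.inr_injective h)
    · replace h : ofEdge (κ := κ) ι e = ofEdge ι k := h
      by_cases he : ∃ b, κ.graph.onE b = Sum.inr e <;>
        by_cases hk : ∃ b, κ.graph.onE b = Sum.inr k
      · obtain ⟨b, hb⟩ := he
        obtain ⟨c, hc⟩ := hk
        obtain ⟨e', h1, h2⟩ := hofE b e hb
        obtain ⟨k', h3, h4⟩ := hofE c k hc
        rw [h2, h4] at h
        obtain rfl := hE (h1.trans ((congrArg Sum.inr
          (Sum.inl_injective (Sum.inr_injective h))).trans h3.symm))
        exact Sum.inr_injective (hb.symm.trans hc)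
      · obtain ⟨b, hb⟩ := he
        obtain ⟨e', h1, h2⟩ := hofE b e hb
        rw [h2, ofEdge_of_not ι k hk] at h
        exact absurd (Sum.inr_injective h) Sum.inl_ne_inr
      · obtain ⟨c, hc⟩ := hk
        obtain ⟨k', h3, h4⟩ := hofE c k hc
        rw [h4, ofEdge_of_not ι e he] at h
        exact absurd (Sum.inr_injective h) Sum.inr_ne_inl
      · rw [ofEdge_of_not ι e he, ofEdge_of_not ι k hk] at h
        exact congrArg Subtype.val (Sum.inr_injective (Sum.inr_injective h))
    · show ∃ e', ofEdge (κ := κ) ι e = Sum.inr e'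
      by_cases he : ∃ b, κ.graph.onE b = Sum.inr e
      · obtain ⟨b, hb⟩ := he
        obtain ⟨e', -, h2⟩ := hofE b e hb
        exact ⟨_, h2⟩
      · exact ⟨_, ofEdge_of_not ι e he⟩
  embedding v := by
    show SmoothSet.IsEmbedding (ofMode hκ ι v).2
    by_cases h : ∃ b, κ.graph.onV b = v
    · obtain ⟨b, rfl⟩ := h
      rw [ofMode_onV]
      have : IsIso (κ.map b) := hκ.diffeo b
      exact (SmoothSet.IsDiffeo.isEmbedding (g := inv (κ.map b))
        (inferInstanceAs (IsIso (inv (κ.map b))))).comp (hι.embedding b)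
    · rw [ofMode_of_not hκ ι v h]
      exact SmoothSet.IsDiffeo.isEmbedding (inferInstanceAs (IsIso (𝟙 (H.mode v).toSmoothSet)))

end Glue

theorem isDirected_compCospan {A B C : MetricHybridSystem.{u}} (M : DirectedHybridSystem B C)
    (N : DirectedHybridSystem A B) : (compCospan M N).IsDirected where
  init_embedding := N.directed.init_embedding.comp
    (Glue.inr_isEmbedding N.directed.fin_final M.directed.init_embedding)
  fin_final := M.directed.fin_final.comp (Glue.inl_isFinal N.directed.fin_final M.init)
  chain ε T hε hT x := by
    have hM : ∀ q : M.sys.State, ∃ y : C.State, Reach M.sys ε T (Hom.onState M.fin y) 0 q := by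
      intro q
      obtain ⟨y, hy⟩ := M.directed.chain ε T hε hT q
      exact ⟨y, nonempty_chain_iff.1 hy⟩
    have h1 : ∃ z : C.State, Reach (compSystem M N) ε T
        (Hom.onState (compInl M N) (Hom.onState M.fin z)) 0 x := by
      obtain ⟨v | v, x⟩ := x
      · obtain ⟨z, hz⟩ := hM ⟨v, x⟩
        exact ⟨z, reach_compInl M N hz⟩
      · obtain ⟨y, hy⟩ := N.directed.chain ε T hε hT ⟨v.1, x⟩
        obtain ⟨z, hz⟩ := reach_compInr M N hM (nonempty_chain_iff.1 hy) le_rfl v.2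
        rw [onState_compInr_of_not M N ⟨v.1, x⟩ v.2] at hz
        exact ⟨z, hz⟩
    obtain ⟨z, hz⟩ := h1
    refine ⟨z, nonempty_chain_iff.2 ?_⟩
    have h3 : Hom.onState (compCospan M N).fin z =
        Hom.onState (compInl M N) (Hom.onState M.fin z) :=
      congrArg (Sigma.mk _) (SmoothSet.app_comp _ _ _)
    exact h3 ▸ hz

end HybridDH

/-! ### The double category, from the universal property -/

namespace HybridDH

section DoubleCategory

/-- The unit directed system. -/
def unitDirected (A : MetricHybridSystem.{u}) : DirectedHybridSystem A A :=
  ⟨unitCospan A, isDirected_unitCospan A⟩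

/-- The sequential composition of directed systems. -/
noncomputable def compDirected {A B C : MetricHybridSystem.{u}} (M : DirectedHybridSystem B C)
    (N : DirectedHybridSystem A B) : DirectedHybridSystem A C :=
  ⟨compCospan M N, isDirected_compCospan M N⟩

namespace DirectedSquare

variable {A B C A' B' C' A'' B'' C'' : MetricHybridSystem.{u}}

/-- Apart from its semiconjugacy a square consists of proofs. Every law of the double category thus
becomes an equation of semiconjugacies, once the boundaries are matched. -/
theorem heq_of_hom_eq {f f' : A ⟶ A'} {g g' : B ⟶ B'} {M : DirectedHybridSystem A B}
    {N : DirectedHybridSystem A' B'} {s : DirectedSquare f g M N} {t : DirectedSquare f' g' M N}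
    (hf : f = f') (hg : g = g') (h : s.hom = t.hom) : HEq s t := by
  subst hf hg
  obtain ⟨s, _, _⟩ := s
  obtain ⟨t, _, _⟩ := t
  obtain rfl : s = t := h
  rfl

theorem ext_hom {f : A ⟶ A'} {g : B ⟶ B'} {M : DirectedHybridSystem A B}
    {N : DirectedHybridSystem A' B'} {s t : DirectedSquare f g M N} (h : s.hom = t.hom) : s = t :=
  eq_of_heq (heq_of_hom_eq rfl rfl h)

/-- The vertical identity. -/
def vid (M : DirectedHybridSystem A B) : DirectedSquare (𝟙 A) (𝟙 B) M M where
  hom := 𝟙 M.sys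
  init_comm := by rw [Category.id_comp, Category.comp_id]
  fin_comm := by rw [Category.id_comp, Category.comp_id]

/-- Vertical composition. -/
def vcomp {f : A ⟶ A'} {g : B ⟶ B'} {f' : A' ⟶ A''} {g' : B' ⟶ B''}
    {M : DirectedHybridSystem A B} {N : DirectedHybridSystem A' B'}
    {P : DirectedHybridSystem A'' B''} (s : DirectedSquare f g M N)
    (t : DirectedSquare f' g' N P) : DirectedSquare (f ≫ f') (g ≫ g') M P where
  hom := s.hom ≫ t.hom
  init_comm := by rw [← Category.assoc, s.init_comm, Category.assoc, t.init_comm, Category.assoc]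
  fin_comm := by rw [← Category.assoc, s.fin_comm, Category.assoc, t.fin_comm, Category.assoc]

/-- The unit square of a vertical morphism. -/
def unitSq (f : A ⟶ A') : DirectedSquare f f (unitDirected A) (unitDirected A') where
  hom := f
  init_comm := (Category.id_comp f).trans (Category.comp_id f).symm
  fin_comm := (Category.id_comp f).trans (Category.comp_id f).symm

end DirectedSquare

section Desc

variable {A B C : MetricHybridSystem.{u}} (M : DirectedHybridSystem B C)
  (N : DirectedHybridSystem A B) {L : MetricHybridSystem.{u}}

/-- The semiconjugacy out of a composite that is induced by semiconjugacies out of its parts. -/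
noncomputable def compDesc (f : N.sys ⟶ L) (g : M.sys ⟶ L) (h : N.fin ≫ f = M.init ≫ g) :
    (compDirected M N).sys ⟶ L :=
  (compSystem_isPushout M N).desc f g h

/-- `compInl`, as a morphism to the system of the composite directed system. -/
noncomputable def compL : M.sys ⟶ (compDirected M N).sys := compInl M N

/-- `compInr`, as a morphism to the system of the composite directed system. -/
noncomputable def compR : N.sys ⟶ (compDirected M N).sys := compInr M N

@[simp]
theorem compR_desc (f : N.sys ⟶ L) (g : M.sys ⟶ L) (h : N.fin ≫ f = M.init ≫ g) :
    compR M N ≫ compDesc M N f g h = f :=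
  (compSystem_isPushout M N).inl_desc f g h

@[simp]
theorem compL_desc (f : N.sys ⟶ L) (g : M.sys ⟶ L) (h : N.fin ≫ f = M.init ≫ g) :
    compL M N ≫ compDesc M N f g h = g :=
  (compSystem_isPushout M N).inr_desc f g h

@[simp]
theorem compR_desc_assoc (f : N.sys ⟶ L) (g : M.sys ⟶ L) (h : N.fin ≫ f = M.init ≫ g)
    {L' : MetricHybridSystem.{u}} (k : L ⟶ L') :
    compR M N ≫ compDesc M N f g h ≫ k = f ≫ k := by
  rw [← Category.assoc, compR_desc]

@[simp]
theorem compL_desc_assoc (f : N.sys ⟶ L) (g : M.sys ⟶ L) (h : N.fin ≫ f = M.init ≫ g)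
    {L' : MetricHybridSystem.{u}} (k : L ⟶ L') :
    compL M N ≫ compDesc M N f g h ≫ k = g ≫ k := by
  rw [← Category.assoc, compL_desc]

/-- Applied repeatedly, this reduces a coherence law to one equation per piece, which the rewrite
rules for `compDesc` settle. -/
theorem comp_hom_ext {f g : (compDirected M N).sys ⟶ L} (hr : compR M N ≫ f = compR M N ≫ g)
    (hl : compL M N ≫ f = compL M N ≫ g) : f = g :=
  (compSystem_isPushout M N).hom_ext hr hl

@[simp]
theorem fin_compR : N.fin ≫ compR M N = M.init ≫ compL M N :=
  (compSystem_isPushout M N).w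

@[simp]
theorem fin_compR_assoc (k : (compDirected M N).sys ⟶ L) :
    N.fin ≫ compR M N ≫ k = M.init ≫ compL M N ≫ k := by
  rw [← Category.assoc, fin_compR, Category.assoc]

@[simp]
theorem compDirected_init : (compDirected M N).init = N.init ≫ compR M N := rfl

@[simp]
theorem compDirected_fin : (compDirected M N).fin = M.fin ≫ compL M N := rfl

-- This is `fin_compR` for an iterated composite, stated with the final map of the inner composite
-- already expanded, as `compDirected_fin` leaves it.
@[simp]
theorem fin_compL_compR {D : MetricHybridSystem.{u}} (K : DirectedHybridSystem C D) :
    M.fin ≫ compL M N ≫ compR K (compDirected M N) = K.init ≫ compL K (compDirected M N) := by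
  rw [← fin_compR, compDirected_fin, Category.assoc]

end Desc

/-- The identification of the system of the unit with the object itself. -/
def unitOut (A : MetricHybridSystem.{u}) : (unitDirected A).sys ⟶ A := 𝟙 A

section Unit

variable (A : MetricHybridSystem.{u}) {L : MetricHybridSystem.{u}}

@[simp]
theorem unit_init_out : (unitDirected A).init ≫ unitOut A = 𝟙 A := Category.comp_id (𝟙 A)

@[simp]
theorem unit_fin_out : (unitDirected A).fin ≫ unitOut A = 𝟙 A := Category.comp_id (𝟙 A)

@[simp]
theorem unitOut_init : unitOut A ≫ (unitDirected A).init = 𝟙 _ := Category.comp_id (𝟙 A)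

@[simp]
theorem unitOut_fin : unitOut A ≫ (unitDirected A).fin = 𝟙 _ := Category.comp_id (𝟙 A)

@[simp]
theorem unit_init_out_assoc (k : A ⟶ L) : (unitDirected A).init ≫ unitOut A ≫ k = k := by
  rw [← Category.assoc, unit_init_out, Category.id_comp]

@[simp]
theorem unit_fin_out_assoc (k : A ⟶ L) : (unitDirected A).fin ≫ unitOut A ≫ k = k := by
  rw [← Category.assoc, unit_fin_out, Category.id_comp]

@[simp]
theorem unitOut_init_assoc (k : (unitDirected A).sys ⟶ L) :
    unitOut A ≫ (unitDirected A).init ≫ k = k := by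
  rw [← Category.assoc, unitOut_init, Category.id_comp]

@[simp]
theorem unitOut_fin_assoc (k : (unitDirected A).sys ⟶ L) :
    unitOut A ≫ (unitDirected A).fin ≫ k = k := by
  rw [← Category.assoc, unitOut_fin, Category.id_comp]

@[simp]
theorem unitSq_hom_out {A A' : MetricHybridSystem.{u}} (f : A ⟶ A') :
    (DirectedSquare.unitSq f).hom ≫ unitOut A' = unitOut A ≫ f :=
  (Category.comp_id f).trans (Category.id_comp f).symm

@[simp]
theorem unitSq_hom_out_assoc {A A' : MetricHybridSystem.{u}} (f : A ⟶ A') (k : A' ⟶ L) :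
    (DirectedSquare.unitSq f).hom ≫ unitOut A' ≫ k = unitOut A ≫ f ≫ k := by
  rw [← Category.assoc, unitSq_hom_out, Category.assoc]

end Unit

/-- The final map of the unit is invertible, so the unit's leg into the composite factors through
that of `M`. This gives the unit part of `runit_runitInv`. -/
theorem init_compL_unit {A B : MetricHybridSystem.{u}} (M : DirectedHybridSystem A B) :
    unitOut A ≫ M.init ≫ compL M (unitDirected A) = compR M (unitDirected A) := by
  rw [← fin_compR, unitOut_fin_assoc]

namespace DirectedSquare

variable {A B C D E A' B' C' A'' B'' C'' : MetricHybridSystem.{u}}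

attribute [simp] init_comm fin_comm

@[simp]
theorem init_comm_assoc {f : A ⟶ A'} {g : B ⟶ B'} {M : DirectedHybridSystem A B}
    {N : DirectedHybridSystem A' B'} (s : DirectedSquare f g M N) {L : MetricHybridSystem.{u}}
    (k : N.sys ⟶ L) : M.init ≫ s.hom ≫ k = f ≫ N.init ≫ k := by
  rw [← Category.assoc, s.init_comm, Category.assoc]

@[simp]
theorem fin_comm_assoc {f : A ⟶ A'} {g : B ⟶ B'} {M : DirectedHybridSystem A B}
    {N : DirectedHybridSystem A' B'} (s : DirectedSquare f g M N) {L : MetricHybridSystem.{u}}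
    (k : N.sys ⟶ L) : M.fin ≫ s.hom ≫ k = g ≫ N.fin ≫ k := by
  rw [← Category.assoc, s.fin_comm, Category.assoc]

@[simp]
theorem vid_hom (M : DirectedHybridSystem A B) : (vid M).hom = 𝟙 M.sys := rfl

@[simp]
theorem vcomp_hom {f : A ⟶ A'} {g : B ⟶ B'} {f' : A' ⟶ A''} {g' : B' ⟶ B''}
    {M : DirectedHybridSystem A B} {N : DirectedHybridSystem A' B'}
    {P : DirectedHybridSystem A'' B''} (s : DirectedSquare f g M N)
    (t : DirectedSquare f' g' N P) : (vcomp s t).hom = s.hom ≫ t.hom := rfl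

/-- Horizontal composition of squares. -/
@[simps]
noncomputable def hcomp {f : A ⟶ A'} {g : B ⟶ B'} {h : C ⟶ C'} {M : DirectedHybridSystem B C}
    {M' : DirectedHybridSystem B' C'} {N : DirectedHybridSystem A B}
    {N' : DirectedHybridSystem A' B'} (s : DirectedSquare g h M M') (t : DirectedSquare f g N N') :
    DirectedSquare f h (compDirected M N) (compDirected M' N') where
  -- The two maps agree on `B` because both squares restrict to `g` there and the legs of the target
  -- agree on `B'`.
  hom := compDesc M N (t.hom ≫ compR M' N') (s.hom ≫ compL M' N') (by simp)
  init_comm := by simp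
  fin_comm := by simp

/-- The associator. -/
@[simps]
noncomputable def assoc (M : DirectedHybridSystem C D) (N : DirectedHybridSystem B C)
    (P : DirectedHybridSystem A B) : DirectedSquare (𝟙 A) (𝟙 D)
      (compDirected (compDirected M N) P) (compDirected M (compDirected N P)) where
  -- Both bracketings are glued from `P`, `N` and `M`; each piece is sent to its own copy.
  hom := compDesc _ _ (compR N P ≫ compR M (compDirected N P))
    (compDesc _ _ (compL N P ≫ compR M (compDirected N P)) (compL M (compDirected N P))
      (by simp)) (by simp)
  init_comm := by simp
  fin_comm := by simp

/-- The inverse of the associator. -/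
@[simps]
noncomputable def assocInv (M : DirectedHybridSystem C D) (N : DirectedHybridSystem B C)
    (P : DirectedHybridSystem A B) : DirectedSquare (𝟙 A) (𝟙 D)
      (compDirected M (compDirected N P)) (compDirected (compDirected M N) P) where
  hom := compDesc _ _ (compDesc _ _ (compR (compDirected M N) P)
      (compR M N ≫ compL (compDirected M N) P) (by simp))
    (compL M N ≫ compL (compDirected M N) P) (by simp)
  init_comm := by simp
  fin_comm := by simp

/-- The left unitor. -/
@[simps]
noncomputable def lunit (M : DirectedHybridSystem A B) :
    DirectedSquare (𝟙 A) (𝟙 B) (compDirected (unitDirected B) M) M where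
  -- The unit's copy of `B` is folded back onto the sink of `M`.
  hom := compDesc _ _ (𝟙 M.sys) (unitOut B ≫ M.fin) (by simp)
  init_comm := by simp
  fin_comm := by simp

/-- The inverse of the left unitor. -/
@[simps]
noncomputable def lunitInv (M : DirectedHybridSystem A B) :
    DirectedSquare (𝟙 A) (𝟙 B) M (compDirected (unitDirected B) M) where
  hom := compR _ _
  init_comm := by simp
  fin_comm := by
    rw [fin_compR, compDirected_fin, Category.id_comp]
    -- The initial and final maps of the unit are both the identity.
    rfl

/-- The right unitor. -/
@[simps]
noncomputable def runit (M : DirectedHybridSystem A B) :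
    DirectedSquare (𝟙 A) (𝟙 B) (compDirected M (unitDirected A)) M where
  hom := compDesc _ _ (unitOut A ≫ M.init) (𝟙 M.sys) (by simp)
  init_comm := by simp
  fin_comm := by simp

/-- The inverse of the right unitor. -/
@[simps]
noncomputable def runitInv (M : DirectedHybridSystem A B) :
    DirectedSquare (𝟙 A) (𝟙 B) M (compDirected M (unitDirected A)) where
  hom := compL _ _
  init_comm := by
    rw [← fin_compR, compDirected_init, Category.id_comp]
    rfl
  fin_comm := by simp

end DirectedSquare

open DirectedSquare in
/-- The double category of directed hybrid systems. -/
noncomputable def directedDoubleCategory :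
    PseudoDoubleCategory MetricHybridSystem.{u} DirectedHybridSystem DirectedSquare
      unitDirected compDirected where
  vid := vid
  vcomp := vcomp
  vid_vcomp _ := heq_of_hom_eq (by simp) (by simp) (by simp)
  vcomp_vid _ := heq_of_hom_eq (by simp) (by simp) (by simp)
  vcomp_assoc _ _ _ := heq_of_hom_eq (by simp) (by simp) (by simp)
  unitSq := unitSq
  unitSq_id _ := rfl
  unitSq_comp _ _ := rfl
  hcompSq := hcomp
  hcompSq_vid _ _ := ext_hom (comp_hom_ext _ _ (by simp) (by simp))
  interchange _ _ _ _ := ext_hom (comp_hom_ext _ _ (by simp) (by simp))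
  assoc := assoc
  assocInv := assocInv
  assoc_assocInv _ _ _ := heq_of_hom_eq (by simp) (by simp)
    -- The source is bracketed to the left, so `P` splits off first and the second leg splits into
    -- `N` and `M`.
    (comp_hom_ext _ _ (by simp) (comp_hom_ext _ _ (by simp) (by simp)))
  assocInv_assoc _ _ _ := heq_of_hom_eq (by simp) (by simp)
    (comp_hom_ext _ _ (comp_hom_ext _ _ (by simp) (by simp)) (by simp))
  assoc_naturality _ _ _ := heq_of_hom_eq (by simp) (by simp)
    (comp_hom_ext _ _ (by simp) (comp_hom_ext _ _ (by simp) (by simp)))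
  lunit := lunit
  lunitInv := lunitInv
  lunit_lunitInv M := heq_of_hom_eq (by simp) (by simp) (comp_hom_ext _ _ (by simp) (by simp))
  lunitInv_lunit M := heq_of_hom_eq (by simp) (by simp) (by simp)
  lunit_naturality _ := heq_of_hom_eq (by simp) (by simp) (comp_hom_ext _ _ (by simp) (by simp))
  runit := runit
  runitInv := runitInv
  runit_runitInv M := heq_of_hom_eq (by simp) (by simp) (comp_hom_ext _ _
    (by simp [init_compL_unit]) (by simp))
  runitInv_runit _ := heq_of_hom_eq (by simp) (by simp) (by simp)
  runit_naturality _ := heq_of_hom_eq (by simp) (by simp) (comp_hom_ext _ _ (by simp) (by simp))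
  triangle _ _ := heq_of_hom_eq (by simp) (by simp)
    (comp_hom_ext _ _ (by simp) (comp_hom_ext _ _ (by simp) (by simp)))
  pentagon _ _ _ _ := heq_of_hom_eq (by simp) (by simp)
    -- There are four pieces, `Q`, `P`, `N` and `M`; both sides send each to its copy in the fully
    -- right-bracketed composite.
    (comp_hom_ext _ _ (by simp) (comp_hom_ext _ _ (by simp) (comp_hom_ext _ _ (by simp) (by simp))))

end DoubleCategory

end HybridDH

theorem mainTheorem2 :
    ∃ (hU : ∀ A : MetricHybridSystem.{u}, (unitCospan A).IsDirected)
      (hC : ∀ {A B C : MetricHybridSystem.{u}} (M : DirectedHybridSystem B C) (N : DirectedHybridSystem A B),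
        (compCospan M N).IsDirected)
      (D : PseudoDoubleCategory MetricHybridSystem.{u} DirectedHybridSystem DirectedSquare
        (fun A => ⟨unitCospan A, hU A⟩) (fun M N => ⟨compCospan M N, hC M N⟩)),
      (∀ {A B : MetricHybridSystem.{u}} (M : DirectedHybridSystem A B), (D.vid M).hom = 𝟙 M.sys) ∧
      (∀ {A B A' B' A'' B'' : MetricHybridSystem.{u}} {f : A ⟶ A'} {g : B ⟶ B'}
        {f' : A' ⟶ A''} {g' : B' ⟶ B''} {M : DirectedHybridSystem A B} {N : DirectedHybridSystem A' B'}
        {P : DirectedHybridSystem A'' B''} (s : DirectedSquare f g M N) (t : DirectedSquare f' g' N P),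
        (D.vcomp s t).hom = s.hom ≫ t.hom) ∧
      (∀ {A A' : MetricHybridSystem.{u}} (f : A ⟶ A'), (D.unitSq f).hom = f) ∧
      (∀ {A B C : MetricHybridSystem.{u}} (M : DirectedHybridSystem B C) (N : DirectedHybridSystem A B),
        IsPushout (C := DirGraph.{u}) N.fin.graph M.init.graph (compInr M N).graph
          (compInl M N).graph) ∧
      (∀ {A B C A' B' C' : MetricHybridSystem.{u}} {f : A ⟶ A'} {g : B ⟶ B'} {h : C ⟶ C'}
        {M : DirectedHybridSystem B C} {M' : DirectedHybridSystem B' C'}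
        {N : DirectedHybridSystem A B} {N' : DirectedHybridSystem A' B'}
        (s : DirectedSquare g h M M') (t : DirectedSquare f g N N'),
        compInl M N ≫ (D.hcompSq s t).hom = s.hom ≫ compInl M' N' ∧
        compInr M N ≫ (D.hcompSq s t).hom = t.hom ≫ compInr M' N') := by
  refine ⟨isDirected_unitCospan, isDirected_compCospan, directedDoubleCategory, fun _ => rfl,
    fun _ _ => rfl, fun _ => rfl,
    fun M N => Glue.graph_isPushout N.directed.fin_final M.init, fun s t => ⟨?_, ?_⟩⟩
  · exact compL_desc _ _ _ _ _
  · exact compR_desc _ _ _ _ _
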